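/- \textbf{Setting.} Let $\mathbb S=\mathbb R^k$, let $\mathcal A$ be a finite discrete set (actions), and let $\mathbb R^d$ be the space of network weights. Let $p(\cdot\mid x,a,\theta)$, $(x,a,\theta)\in\mathbb S\times\mathcal A\times\mathbb R^d$, be probability measures on $\mathbb S$ depending continuously (for weak convergence) on $(x,a,\theta)$. On a probability space let $x_n\in\mathbb S$, $a_n\in\mathcal A$, $\theta_n\in\mathbb R^d$ $(n\ge 0)$ be random variables such that, for every $n$, the conditional law of $x_{n+1}$ given $\sigma(x_m,a_m,\theta_m\mid m\le n)$ is $p(\cdot\mid x_n,a_n,\theta_n)$, and such that $\sup_n\|x_n\|<\infty$ and $\sup_n\|\theta_n\|<\infty$ almost surely. (The weights may be updated in any way, in particular by Deep Q-Learning.) Let $\gamma(n)>0$ be step sizes with $\sum_n\gamma(n)=\infty$ and $\sum_n\gamma(n)^2<\infty$, eventually monotonic. Put $t_n=\sum_{m<n}\gamma(m)$, let $\mu(t)=\delta_{(x_n,a_n)}$ for $t\in[t_n,t_{n+1})$, and let $\overline\theta$ be the piecewise linear interpolation with $\overline\theta(t_n)=\theta_n$. Let $\mathcal S^k$ be the unit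 sphere of $\mathbb R^{k+1}$, the one-point compactification of $\mathbb S$ via inverse stereographic projection; measures on $\mathbb S\times\mathcal A$ are identified with their push-forwards to $\mathcal S^k\times\mathcal A$. Let $\mathcal U$ be the space of all (Lebesgue) measurable functions $\nu:[0,\infty)\to\mathcal P(\mathcal S^k\times\mathcal A)$ with the coarsest topology making $\nu\mapsto\int_0^T g(t)\int f\,d\nu(t)\,dt$ continuous for all $T>0$, $f\in C(\mathcal S^k\times\mathcal A)$ and $g\in L^2([0,T])$. This topology does not distinguish functions that agree for almost every $t$. \textbf{Lemma.} Almost surely the following holds. Let $n_1<n_2<\cdots$ and $\mu^\infty\in\mathcal U$ be such that $\mu(t_{n_j}+\cdot)\to\mu^\infty$ in $\mathcal U$. (1) If $\theta^\infty\in C([0,\infty),\mathbb R^d)$ and $\overline\theta(t_{n_j}+\cdot)\to\theta^\infty$ uniformly on every $[0,T]$, then $\mu^\infty$ agrees, for almost every $t$, with a measurable function $\nu:[0,\infty)\to\mathcal P(\mathbb S\times\mathcal A)$ such that, for all $t\in[0,\infty)$, $$\nu(t,dy\times\mathcal A)=\int_{\mathbb S\times\mathcal A}p(dy\mid x,a,\theta^\infty(t))\,\nu(t,dx,da).$$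 In particular, every representative $\mu^\infty$ satisfies this equation (and gives no mass to the point at infinity) for almost every $t$. In other words, the limiting state marginal is stationary for the controlled state Markov chain. (2) If $p(\cdot\mid x,a,\theta)$ does not depend on $\theta$ for fixed $(x,a)$, then the conclusion of (1) holds for every function $\theta^\infty:[0,\infty)\to\mathbb R^d$, without any assumption on the convergence of the weights. -/

import Mathlib

open MeasureTheory Filter Topology
open scoped NNReal ENNReal

noncomputable section

namespace DQN

/-! ### The compactified state space -/

/-- The state space `ℝᵏ` (and also, with another exponent, the space of network weights). -/
abbrev Euc (k : ℕ) : Type := EuclideanSpace ℝ (Fin k)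

/-- The unit sphere of `ℝᵏ⁺¹`, which is the one-point compactification of `ℝᵏ`. -/
abbrev Sph (k : ℕ) : Type := Metric.sphere (0 : Euc (k + 1)) 1

/-- The north pole `(0, …, 0, 1)`. -/
def northPole (k : ℕ) : Sph k :=
  ⟨EuclideanSpace.single (Fin.last k) 1, by simp⟩

/-- Inverse stereographic projection from the north pole: it identifies `ℝᵏ` with the sphere
without the north pole. -/
def invStereo (k : ℕ) (x : Euc k) : Sph k :=
  haveI : Fact (Module.finrank ℝ (Euc (k + 1)) = k + 1) := ⟨by simp⟩
  (stereographic' k (northPole k)).symm x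

/-! ### Measure-valued paths -/

/-- Lebesgue measure on the half line `[0, ∞)`. -/
def halfLine : Measure ℝ≥0 := (volume : Measure ℝ).comap (fun t : ℝ≥0 => (t : ℝ))

/-- The (Lebesgue) measurable functions from `[0, ∞)` to the probability measures on `X`. For
`X = 𝒮ᵏ × 𝒜` this is the space `𝒰`. -/
def MeasurePath (X : Type*) [MeasurableSpace X] : Type _ :=
  {ν : ℝ≥0 → ProbabilityMeasure X // AEMeasurable ν halfLine}

instance {X : Type*} [MeasurableSpace X] :
    CoeFun (MeasurePath X) (fun _ => ℝ≥0 → ProbabilityMeasure X) := ⟨Subtype.val⟩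

/-- The functional `ν ↦ ∫₀ᵀ g(t) ∫ f dν(t) dt`. -/
def pairing {X : Type*} [TopologicalSpace X] [MeasurableSpace X]
    (T : ℝ≥0) (g : ℝ≥0 → ℝ) (f : C(X, ℝ)) (ν : MeasurePath X) : ℝ :=
  ∫ t in Set.Icc 0 T, g t * ∫ z, f z ∂(ν t : Measure X) ∂halfLine

/-- The coarsest topology for which `ν ↦ ∫₀ᵀ g(t) ∫ f dν(t) dt` is continuous for all `T > 0`,
all `g ∈ L²([0, T])` and all continuous functions `f` on the compact space `X`. -/
instance {X : Type*} [TopologicalSpace X] [CompactSpace X] [MeasurableSpace X] :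
    TopologicalSpace (MeasurePath X) :=
  ⨅ (T : ℝ≥0) (_ : 0 < T) (g : ℝ≥0 → ℝ) (_ : MemLp g 2 (halfLine.restrict (Set.Icc 0 T)))
    (f : C(X, ℝ)), TopologicalSpace.induced (pairing T g f) inferInstance

/-! ### The time scale and the interpolated processes -/

/-- `t₀ = 0`, `tₙ = γ(0) + ⋯ + γ(n - 1)`. -/
def epoch (γ : ℕ → ℝ) (n : ℕ) : ℝ := ∑ m ∈ Finset.range n, γ m

/-- `sup {n | tₙ ≤ t}`: the index `n` with `t ∈ [tₙ, tₙ₊₁)`. -/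
def stepIndex (γ : ℕ → ℝ) (t : ℝ) : ℕ := sSup {n | epoch γ n ≤ t}

theorem measurable_stepIndex (γ : ℕ → ℝ) : Measurable (stepIndex γ) := by
  have key : stepIndex γ = fun t => ⨆ n : ℕ, if epoch γ n ≤ t then n else 0 := by
    funext t
    have hsub : Set.range (fun n : ℕ => if epoch γ n ≤ t then n else 0) ⊆
        insert 0 {n | epoch γ n ≤ t} := by
      rintro _ ⟨n, rfl⟩
      by_cases h : epoch γ n ≤ t <;> simp [h]
    have hsup : {n | epoch γ n ≤ t} ⊆
        Set.range (fun n : ℕ => if epoch γ n ≤ t then n else 0) := by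
      intro n hn
      exact ⟨n, if_pos hn⟩
    by_cases hb : BddAbove {n | epoch γ n ≤ t}
    · apply le_antisymm
      · rcases Set.eq_empty_or_nonempty {n | epoch γ n ≤ t} with he | hne
        · simp [stepIndex, he]
        · exact csSup_le_csSup ((hb.insert 0).mono hsub) hne hsup
      · refine ciSup_le fun n => ?_
        by_cases h : epoch γ n ≤ t
        · rw [if_pos h]
          exact le_csSup hb h
        · rw [if_neg h]
          exact Nat.zero_le _
    · have hb' : ¬ BddAbove (Set.range (fun n : ℕ => if epoch γ n ≤ t then n else 0)) :=
        fun h => hb (h.mono hsup)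
      rw [stepIndex, iSup, Nat.sSup_of_not_bddAbove hb, Nat.sSup_of_not_bddAbove hb']
  rw [key]
  exact Measurable.iSup fun n =>
    Measurable.ite (measurableSet_le measurable_const measurable_id) measurable_const
      measurable_const

/-- For a sequence of points `z₀, z₁, …`, let `μ(t) = δ_{zₙ}` for `t ∈ [tₙ, tₙ₊₁)`. This is the
left-shifted path `t ↦ μ(tₙ + t)`. -/
def shiftedDirac {X : Type*} [MeasurableSpace X] (γ : ℕ → ℝ) (z : ℕ → X) (n : ℕ) :
    MeasurePath X :=
  ⟨fun t => diracProba (z (stepIndex γ (epoch γ n + t))), by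
    refine Measurable.aemeasurable ?_
    have h : Measurable fun m : ℕ => diracProba (z m) := measurable_from_top
    exact h.comp ((measurable_stepIndex γ).comp (measurable_const.add measurable_subtype_coe))⟩

/-- The piecewise linear interpolation `θ̄` with `θ̄(tₙ) = θₙ`. -/
def interp {d : ℕ} (γ : ℕ → ℝ) (θ : ℕ → Euc d) (t : ℝ) : Euc d :=
  let n := stepIndex γ t
  θ n + ((t - epoch γ n) / (epoch γ (n + 1) - epoch γ n)) • (θ (n + 1) - θ n)

/-! ### The controlled Markov process -/

/-- The history `σ(x_m, a_m, θ_m | m ≤ n)`. -/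
abbrev history {Ω A : Type*} [MeasurableSpace A] {k d : ℕ}
    (x : ℕ → Ω → Euc k) (a : ℕ → Ω → A) (θ : ℕ → Ω → Euc d) (n : ℕ) : MeasurableSpace Ω :=
  ⨆ m ∈ Set.Iic n, MeasurableSpace.comap (fun ω => (x m ω, a m ω, θ m ω)) inferInstance

/-- Given the history up to time `n`, the next state `x_{n+1}` has law `p(· | x_n, a_n, θ_n)`. -/
def IsControlled {Ω A : Type*} [MeasurableSpace A] [MeasurableSpace Ω] (P : Measure Ω) {k d : ℕ}
    (p : Euc k → A → Euc d → ProbabilityMeasure (Euc k))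
    (x : ℕ → Ω → Euc k) (a : ℕ → Ω → A) (θ : ℕ → Ω → Euc d) : Prop :=
  ∀ (n : ℕ) (B : Set (Euc k)), MeasurableSet B →
    P[(x (n + 1) ⁻¹' B).indicator (fun _ => (1 : ℝ)) | history x a θ n] =ᵐ[P]
      fun ω => (p (x n ω) (a n ω) (θ n ω) : Measure (Euc k)).real B

/-- The state marginal of `ν` is stationary for the kernel with weights `θ`:
`ν(dy × 𝒜) = ∫ p(dy | x, a, θ) ν(dx, da)`. -/
def StationaryMarginal {A : Type*} [MeasurableSpace A] {k d : ℕ}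
    (p : Euc k → A → Euc d → ProbabilityMeasure (Euc k)) (θ : Euc d)
    (ν : ProbabilityMeasure (Euc k × A)) : Prop :=
  ∀ B : Set (Euc k), MeasurableSet B →
    (ν : Measure (Euc k × A)) (B ×ˢ Set.univ) =
      ∫⁻ z, (p z.1 z.2 θ : Measure (Euc k)) B ∂(ν : Measure (Euc k × A))

/-- A path `μ∞` in `𝒰` is, up to a null set of times, (the push-forward of) a measurable path `ν` of
probability measures on `ℝᵏ × 𝒜`, the state marginal of which is stationary for the weights
`θ∞(t)` at every time `t ≥ 0`. -/
def StationaryAlong {A : Type*} [MeasurableSpace A] {k d : ℕ}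
    (p : Euc k → A → Euc d → ProbabilityMeasure (Euc k)) (θlim : ℝ≥0 → Euc d)
    (μlim : MeasurePath (Sph k × A)) : Prop :=
  ∃ ν : MeasurePath (Euc k × A),
    (∀ᵐ t ∂halfLine, (μlim t : Measure (Sph k × A)) =
      (ν t : Measure (Euc k × A)).map (Prod.map (invStereo k) id)) ∧
    ∀ t : ℝ≥0, StationaryMarginal p (θlim t) (ν t)

end DQN

end

/-!
For a continuous function `f` on the sphere, the weighted noise
`∑ γ(m) (f(x_{m+1}) - ∫ f dp(x_m, a_m, θ_m))` is a martingale with square summable increments, hence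
it converges almost surely (`ae_exists_tendsto_noise`). As the steps are eventually monotone, they
have bounded variation, so a summation by parts replaces `x_{m+1}` by `x_m`
(`exists_tendsto_sum_of_shift`). On the time scale `tₙ` this says that the integrals of the defect
`f(x) - ∫ f dp(x, a, θ)` over windows of fixed length tend to `0` (`tendsto_setIntegral_window`). It
suffices to have this for countably many `f`, dense in the continuous functions, so there is one
exceptional null set.

On a fixed trajectory the states stay in a ball, and Tietze's theorem gives a continuous map `r` from
the sphere to `ℝᵏ` that inverts `invStereo` on this ball. Replacing `x` by `r` of the state turns the
chain into one on a compact space, with a weakly continuous kernel (`sphereKernel`), for which the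
defects form continuous curves in the space of continuous functions. Convergence in `𝒰` extends from
test functions `g(t) f(z)` to such curves (`tendsto_integral_path`), so that the integral of the
defect with respect to the limit path vanishes over every time interval, and by Lebesgue
differentiation at almost every time (`ae_forall_defect_integral_eq_zero`). In the same way the limit
lives on the set of states at which `r` inverts `invStereo`, and there stationarity of the
compactified chain is stationarity of the original one (`stationaryMarginal_pullState`).

Stationarity is a closed condition on pairs of weights and measures. Since the probability measures
on a compact space are compact and sets of full measure are dense in time, a stationary measure
exists at every time, and the path can be corrected on a null set (`exists_path_forall_mem`).

If the kernel does not depend on the weights, all this applies with a constant limit curve.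
-/

namespace DQN

/-! ### Integration on the half line -/

theorem measurableEmbedding_coe_nnreal : MeasurableEmbedding ((↑) : ℝ≥0 → ℝ) :=
  MeasurableEmbedding.subtype_coe measurableSet_Ici

theorem map_coe_halfLine : halfLine.map ((↑) : ℝ≥0 → ℝ) = volume.restrict (Set.Ici 0) := by
  rw [halfLine, measurableEmbedding_coe_nnreal.map_comap]
  congr 1
  ext t
  exact ⟨fun ⟨s, hs⟩ => hs ▸ s.2, fun h => ⟨⟨t, h⟩, rfl⟩⟩

theorem coe_nnreal_preimage_Icc (T : ℝ≥0) :
    ((↑) : ℝ≥0 → ℝ) ⁻¹' Set.Icc 0 T = Set.Icc 0 T := by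
  ext t
  simp

theorem halfLine_apply_Icc (T : ℝ≥0) : halfLine (Set.Icc 0 T) = ENNReal.ofReal T := by
  rw [← coe_nnreal_preimage_Icc, ← measurableEmbedding_coe_nnreal.map_apply, map_coe_halfLine,
    Measure.restrict_apply measurableSet_Icc,
    Set.inter_eq_left.2 (fun _ h => h.1), Real.volume_Icc, sub_zero]

instance isFiniteMeasure_halfLine_restrict_Icc (T : ℝ≥0) :
    IsFiniteMeasure (halfLine.restrict (Set.Icc 0 T)) :=
  ⟨by simp [halfLine_apply_Icc]⟩

theorem setIntegral_halfLine (T : ℝ≥0) (F : ℝ → ℝ) :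
    ∫ t in Set.Icc 0 T, F t ∂halfLine = ∫ t in (0 : ℝ)..T, F t := by
  rw [← coe_nnreal_preimage_Icc, ← measurableEmbedding_coe_nnreal.setIntegral_map,
    map_coe_halfLine, Measure.restrict_restrict measurableSet_Icc,
    Set.inter_eq_left.2 (fun _ h => h.1), integral_Icc_eq_integral_Ioc,
    intervalIntegral.integral_of_le T.coe_nonneg]

theorem ae_halfLine_iff {p : ℝ → Prop} :
    (∀ᵐ t : ℝ≥0 ∂halfLine, p t) ↔ ∀ᵐ t : ℝ ∂volume.restrict (Set.Ici 0), p t := by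
  rw [← map_coe_halfLine, measurableEmbedding_coe_nnreal.ae_map_iff]

/-- Sets of full Lebesgue measure are dense in the half line. -/
theorem dense_of_ae_halfLine {s : Set ℝ≥0} (hs : ∀ᵐ t ∂halfLine, t ∈ s) : Dense s := by
  refine dense_iff_inter_open.2 fun U hU ⟨u, hu⟩ => ?_
  by_contra hne
  have hnull : halfLine U = 0 := by
    refine measure_mono_null (fun t ht hts => hne ⟨t, ht, hts⟩) hs
  obtain ⟨ε, hε, hball⟩ := Metric.isOpen_iff.1 hU u hu
  have hsub : Set.Ioo (u : ℝ) (u + ε) ⊆ ((↑) : ℝ≥0 → ℝ) '' U := by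
    intro t ht
    have ht0 : 0 ≤ t := u.2.trans ht.1.le
    lift t to ℝ≥0 using ht0
    refine ⟨t, hball ?_, rfl⟩
    rw [Metric.mem_ball, NNReal.dist_eq, abs_lt]
    constructor <;> linarith [ht.1, ht.2]
  rw [halfLine, measurableEmbedding_coe_nnreal.comap_apply] at hnull
  have := measure_mono_null hsub hnull
  simp [hε.not_ge] at this

/-- Lebesgue differentiation: a function with vanishing primitive vanishes almost everywhere. -/
theorem ae_eq_zero_of_forall_setIntegral_Icc {F : ℝ≥0 → ℝ}
    (hint : ∀ T, IntegrableOn F (Set.Icc 0 T) halfLine)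
    (hzero : ∀ T, ∫ t in Set.Icc 0 T, F t ∂halfLine = 0) : F =ᵐ[halfLine] 0 := by
  set G : ℝ → ℝ := fun t => F t.toNNReal with hG
  have hFG : ∀ t : ℝ≥0, F t = G t := fun t => by simp [hG]
  have hGint : ∀ n : ℕ, IntervalIntegrable G volume 0 n := by
    intro n
    rw [intervalIntegrable_iff_integrableOn_Icc_of_le n.cast_nonneg]
    have h := hint n
    have hcomp : F = G ∘ ((↑) : ℝ≥0 → ℝ) := funext hFG
    rw [hcomp, ← coe_nnreal_preimage_Icc, ← measurableEmbedding_coe_nnreal.integrableOn_map_iff,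
      map_coe_halfLine, IntegrableOn, Measure.restrict_restrict measurableSet_Icc,
      Set.inter_eq_left.2 (fun _ h => h.1)] at h
    simpa [IntegrableOn] using h
  have hGzero : ∀ t : ℝ, 0 ≤ t → ∫ s in (0 : ℝ)..t, G s = 0 := by
    intro t ht
    lift t to ℝ≥0 using ht
    rw [← setIntegral_halfLine]
    simpa only [← hFG] using hzero t
  have key : ∀ᵐ t : ℝ, 0 < t → G t = 0 := by
    have h : ∀ᵐ t : ℝ, ∀ n : ℕ, t ∈ Set.uIcc (0 : ℝ) n → ∀ c ∈ Set.uIcc (0 : ℝ) n,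
        HasDerivAt (fun t => ∫ s in c..t, G s) (G t) t :=
      ae_all_iff.2 fun n => (hGint n).ae_hasDerivAt_integral
    filter_upwards [h] with t ht hpos
    obtain ⟨n, hn⟩ := exists_nat_gt t
    have hder := ht n (Set.mem_uIcc_of_le hpos.le hn.le) 0 Set.left_mem_uIcc
    have hconst : (fun t => ∫ s in (0 : ℝ)..t, G s) =ᶠ[𝓝 t] fun _ => 0 := by
      filter_upwards [lt_mem_nhds hpos] with s hs using hGzero s hs.le
    exact (hder.congr_of_eventuallyEq hconst.symm).unique (hasDerivAt_const t (0 : ℝ))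
  have hres : ∀ᵐ t : ℝ ∂volume.restrict (Set.Ici 0), G t = 0 := by
    rw [ae_restrict_iff' measurableSet_Ici]
    have h0 : ∀ᵐ t : ℝ, t ≠ 0 := by simp [ae_iff, measure_singleton]
    filter_upwards [key, h0] with t ht h0 hmem
    exact ht (lt_of_le_of_ne hmem (Ne.symm h0))
  filter_upwards [ae_halfLine_iff.2 hres] with t ht
  rw [hFG, ht, Pi.zero_apply]

/-! ### Time-dependent test functions -/

section Paths

variable {X : Type*} [TopologicalSpace X] [CompactSpace X] [MeasurableSpace X]

theorem abs_integral_le_norm (m : ProbabilityMeasure X) (c : C(X, ℝ)) :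
    |∫ z, c z ∂(m : Measure X)| ≤ ‖c‖ := by
  have h := norm_integral_le_of_norm_le_const (μ := (m : Measure X))
    (ae_of_all _ fun z => c.norm_coe_le_norm z)
  simpa using h

theorem tendsto_pairing {ν : ℕ → MeasurePath X} {νlim : MeasurePath X}
    (h : Tendsto ν atTop (𝓝 νlim)) {T : ℝ≥0} (hT : 0 < T) {g : ℝ≥0 → ℝ}
    (hg : MemLp g 2 (halfLine.restrict (Set.Icc 0 T))) (f : C(X, ℝ)) :
    Tendsto (fun j => pairing T g f (ν j)) atTop (𝓝 (pairing T g f νlim)) := by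
  have hcont : Continuous (pairing T g f : MeasurePath X → ℝ) :=
    continuous_iff_le_induced.2 <| iInf_le_of_le T <| iInf_le_of_le hT <| iInf_le_of_le g <|
      iInf_le_of_le hg <| iInf_le _ f
  exact (hcont.tendsto νlim).comp h

variable [BorelSpace X]

theorem integrable_continuousMap (m : ProbabilityMeasure X) (c : C(X, ℝ)) :
    Integrable (fun z => c z) (m : Measure X) :=
  c.continuous.integrable_of_hasCompactSupport (HasCompactSupport.of_compactSpace _)

theorem integral_sub_continuousMap (m : ProbabilityMeasure X) (c c' : C(X, ℝ)) :
    ∫ z, (c - c') z ∂(m : Measure X) =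
      ∫ z, c z ∂(m : Measure X) - ∫ z, c' z ∂(m : Measure X) := by
  simp only [ContinuousMap.sub_apply]
  exact integral_sub (integrable_continuousMap m c) (integrable_continuousMap m c')

variable [SecondCountableTopology X] [TopologicalSpace.PseudoMetrizableSpace X]

/-- Along a measurable path, the integral of a measurable curve of test functions is measurable. -/
theorem aestronglyMeasurable_integral_path (ν : MeasurePath X) {μ : Measure ℝ≥0}
    (hμ : μ ≪ halfLine) {c : ℝ≥0 → C(X, ℝ)} (hc : AEStronglyMeasurable c μ) :
    AEStronglyMeasurable (fun t => ∫ z, c t z ∂(ν t : Measure X)) μ := by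
  have hν : AEMeasurable ν.1 μ := ν.2.mono_ac hμ
  obtain ⟨ν', hν', hνν'⟩ := hν
  let κ : ProbabilityTheory.Kernel ℝ≥0 X :=
    { toFun := fun t => (ν' t : Measure X)
      measurable' := measurable_subtype_coe.comp hν' }
  have : ProbabilityTheory.IsMarkovKernel κ :=
    ⟨fun t => inferInstanceAs (IsProbabilityMeasure (ν' t : Measure X))⟩
  have hjoint : StronglyMeasurable fun q : ℝ≥0 × X => hc.mk c q.1 q.2 := by
    have h1 : StronglyMeasurable fun q : ℝ≥0 × X => (hc.mk c q.1, q.2) :=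
      (hc.stronglyMeasurable_mk.comp_measurable measurable_fst).prodMk
        measurable_snd.stronglyMeasurable
    exact ContinuousEval.continuous_eval.comp_stronglyMeasurable h1
  refine ⟨fun t => ∫ z, hc.mk c t z ∂κ t,
    StronglyMeasurable.integral_kernel_prod_right (κ := κ) hjoint, ?_⟩
  filter_upwards [hνν', hc.ae_eq_mk] with t h1 h2
  show _ = ∫ z, hc.mk c t z ∂(ν' t : Measure X)
  rw [← h1, ← h2]

theorem integrable_integral_path (ν : MeasurePath X) {μ : Measure ℝ≥0}
    (hμ : μ ≪ halfLine) {c : ℝ≥0 → C(X, ℝ)} (hc : Integrable c μ) :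
    Integrable (fun t => ∫ z, c t z ∂(ν t : Measure X)) μ :=
  hc.norm.mono' (aestronglyMeasurable_integral_path ν hμ hc.1)
    (ae_of_all _ fun t => abs_integral_le_norm (ν t) (c t))

/-- The topology of `MeasurePath X` only tests products `g(t) f(z)`; by density of simple functions
in `L¹([0, T]; C(X))` convergence also holds for time-dependent test functions. -/
theorem tendsto_integral_path {ν : ℕ → MeasurePath X} {νlim : MeasurePath X}
    (h : Tendsto ν atTop (𝓝 νlim)) {T : ℝ≥0} (hT : 0 < T) {c : ℝ≥0 → C(X, ℝ)}
    (hc : IntegrableOn c (Set.Icc 0 T) halfLine) :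
    Tendsto (fun j => ∫ t in Set.Icc 0 T, ∫ z, c t z ∂(ν j t : Measure X) ∂halfLine) atTop
      (𝓝 (∫ t in Set.Icc 0 T, ∫ z, c t z ∂(νlim t : Measure X) ∂halfLine)) := by
  have hac : halfLine.restrict (Set.Icc 0 T) ≪ halfLine := Measure.absolutelyContinuous_restrict
  let L (ν : MeasurePath X) (c : ℝ≥0 → C(X, ℝ)) : ℝ :=
    ∫ t in Set.Icc 0 T, ∫ z, c t z ∂(ν t : Measure X) ∂halfLine
  have hcongr : ∀ ν : MeasurePath X, ∀ c c' : ℝ≥0 → C(X, ℝ),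
      c =ᵐ[halfLine.restrict (Set.Icc 0 T)] c' → L ν c = L ν c' := fun ν c c' hcc' =>
    integral_congr_ae (hcc'.mono fun t ht => by simp only [ht])
  refine Integrable.induction (μ := halfLine.restrict (Set.Icc 0 T))
    (fun c => Tendsto (fun j => L (ν j) c) atTop (𝓝 (L νlim c))) ?_ ?_ ?_ ?_ hc
  · intro f s hs _
    have hLp : MemLp (s.indicator fun _ => (1 : ℝ)) 2 (halfLine.restrict (Set.Icc 0 T)) :=
      (memLp_const 1).indicator hs
    have heq : ∀ ν, L ν (s.indicator fun _ => f) = pairing T (s.indicator fun _ => 1) f ν := by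
      intro ν
      refine integral_congr_ae (ae_of_all _ fun t => ?_)
      by_cases ht : t ∈ s <;> simp [ht]
    simpa only [heq] using tendsto_pairing h hT hLp f
  · intro f g _ hf hg hLf hLg
    have hadd : ∀ ν, L ν (f + g) = L ν f + L ν g := by
      intro ν
      rw [← integral_add (integrable_integral_path ν hac hf) (integrable_integral_path ν hac hg)]
      refine integral_congr_ae (ae_of_all _ fun t => ?_)
      exact integral_add (integrable_continuousMap _ (f t)) (integrable_continuousMap _ (g t))
    simpa only [hadd] using hLf.add hLg
  · have hlip : ∀ ν, LipschitzWith 1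
        fun f : ℝ≥0 →₁[halfLine.restrict (Set.Icc 0 T)] C(X, ℝ) => L ν f := by
      refine fun ν => LipschitzWith.of_dist_le_mul fun f g => ?_
      have hf := L1.integrable_coeFn f
      have hg := L1.integrable_coeFn g
      have hsub : L ν f - L ν g = ∫ t in Set.Icc 0 T, ∫ z, (f t - g t) z ∂(ν t : Measure X)
          ∂halfLine := by
        rw [← integral_sub (integrable_integral_path ν hac hf) (integrable_integral_path ν hac hg)]
        exact integral_congr_ae (ae_of_all _ fun t => (integral_sub_continuousMap _ _ _).symm)
      rw [Real.dist_eq, hsub, NNReal.coe_one, one_mul, L1.dist_eq_integral_dist, ← Real.norm_eq_abs]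
      refine norm_integral_le_of_norm_le (hf.sub hg).norm.norm (ae_of_all _ fun t => ?_) |>.trans ?_
      · simpa using abs_integral_le_norm (ν t) (f t - g t)
      · simp [dist_eq_norm]
    exact (LipschitzWith.uniformEquicontinuous _ 1 fun j => hlip (ν j)).equicontinuous
      |>.isClosed_setOfPred_tendsto (hlip νlim).continuous
  · intro f g hfg _ hf
    simpa only [← hcongr _ f g hfg] using hf

end Paths

/-! ### The time scale -/

section TimeScale

variable {γ : ℕ → ℝ}

theorem epoch_succ (γ : ℕ → ℝ) (n : ℕ) : epoch γ (n + 1) = epoch γ n + γ n :=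
  Finset.sum_range_succ _ _

theorem strictMono_epoch (hpos : ∀ n, 0 < γ n) : StrictMono (epoch γ) :=
  strictMono_nat_of_lt_succ fun n => by linarith [epoch_succ γ n, hpos n]

theorem tendsto_epoch (hpos : ∀ n, 0 < γ n) (hsum : ¬ Summable γ) :
    Tendsto (epoch γ) atTop atTop :=
  (not_summable_iff_tendsto_nat_atTop_of_nonneg fun n => (hpos n).le).1 hsum

theorem epoch_nonneg (hpos : ∀ n, 0 < γ n) (n : ℕ) : 0 ≤ epoch γ n :=
  Finset.sum_nonneg fun m _ => (hpos m).le

theorem bddAbove_epoch_le (hpos : ∀ n, 0 < γ n) (hsum : ¬ Summable γ) (t : ℝ) :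
    BddAbove {n | epoch γ n ≤ t} := by
  obtain ⟨N, hN⟩ := ((tendsto_epoch hpos hsum).eventually_gt_atTop t).exists
  refine ⟨N, fun n hn => ?_⟩
  exact ((strictMono_epoch hpos).lt_iff_lt.1 (lt_of_le_of_lt hn hN)).le

theorem le_stepIndex (hpos : ∀ n, 0 < γ n) (hsum : ¬ Summable γ) {n : ℕ} {t : ℝ}
    (h : epoch γ n ≤ t) : n ≤ stepIndex γ t :=
  le_csSup (bddAbove_epoch_le hpos hsum t) h

theorem epoch_stepIndex_le (hpos : ∀ n, 0 < γ n) (hsum : ¬ Summable γ) {t : ℝ} (ht : 0 ≤ t) :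
    epoch γ (stepIndex γ t) ≤ t :=
  Nat.sSup_mem (s := {n | epoch γ n ≤ t}) ⟨0, by simpa [epoch] using ht⟩
    (bddAbove_epoch_le hpos hsum t)

theorem lt_epoch_stepIndex_succ (hpos : ∀ n, 0 < γ n) (hsum : ¬ Summable γ) (t : ℝ) :
    t < epoch γ (stepIndex γ t + 1) := by
  by_contra! h
  exact absurd (le_stepIndex hpos hsum h) (by simp)

theorem stepIndex_eq (hpos : ∀ n, 0 < γ n) (hsum : ¬ Summable γ) {n : ℕ} {t : ℝ}
    (h₁ : epoch γ n ≤ t) (h₂ : t < epoch γ (n + 1)) : stepIndex γ t = n := by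
  refine le_antisymm ?_ (le_stepIndex hpos hsum h₁)
  have h := (epoch_stepIndex_le hpos hsum ((epoch_nonneg hpos n).trans h₁)).trans_lt h₂
  exact Nat.lt_succ_iff.1 ((strictMono_epoch hpos).lt_iff_lt.1 h)

theorem tendsto_stepIndex (hpos : ∀ n, 0 < γ n) (hsum : ¬ Summable γ) :
    Tendsto (stepIndex γ) atTop atTop :=
  tendsto_atTop.2 fun n => (eventually_ge_atTop (epoch γ n)).mono fun _ h =>
    le_stepIndex hpos hsum h

theorem interp_epoch {d : ℕ} (hpos : ∀ n, 0 < γ n) (hsum : ¬ Summable γ) (θ : ℕ → Euc d) (n : ℕ) :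
    interp γ θ (epoch γ n) = θ n := by
  have h : stepIndex γ (epoch γ n) = n :=
    stepIndex_eq hpos hsum le_rfl (strictMono_epoch hpos n.lt_succ_self)
  simp [interp, h]

theorem tendsto_step_zero (hpos : ∀ n, 0 < γ n) (hsq : Summable fun n => γ n ^ 2) :
    Tendsto γ atTop (𝓝 0) := by
  have h := hsq.tendsto_atTop_zero.sqrt
  simpa only [Real.sqrt_sq (hpos _).le, Real.sqrt_zero] using h

/-- Uniform convergence of the interpolated weights gives pointwise convergence of the piecewise
constant ones. -/
theorem tendsto_weights {d : ℕ} (hpos : ∀ n, 0 < γ n) (hsum : ¬ Summable γ)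
    (hsq : Summable fun n => γ n ^ 2) {θ : ℕ → Euc d} {φ : ℕ → ℕ} (hφ : StrictMono φ)
    {θlim : C(ℝ≥0, Euc d)} (hunif : ∀ T : ℝ≥0, TendstoUniformlyOn
      (fun j (t : ℝ≥0) => interp γ θ (epoch γ (φ j) + t)) θlim atTop (Set.Icc 0 T)) (t : ℝ≥0) :
    Tendsto (fun j => θ (stepIndex γ (epoch γ (φ j) + t))) atTop (𝓝 (θlim t)) := by
  set N : ℕ → ℕ := fun j => stepIndex γ (epoch γ (φ j) + t)
  have hle : ∀ j, φ j ≤ N j := fun j => le_stepIndex hpos hsum (by simp)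
  have hNtop : Tendsto N atTop atTop := tendsto_atTop_mono hle hφ.tendsto_atTop
  have hs0 : ∀ j, 0 ≤ epoch γ (N j) - epoch γ (φ j) := fun j =>
    sub_nonneg.2 ((strictMono_epoch hpos).monotone (hle j))
  have hst : ∀ j, epoch γ (N j) ≤ epoch γ (φ j) + t := fun j =>
    epoch_stepIndex_le hpos hsum (add_nonneg (epoch_nonneg hpos _) t.coe_nonneg)
  -- `s j` is the last grid time before `t`, seen from the grid time number `φ j`.
  let s : ℕ → ℝ≥0 := fun j => (epoch γ (N j) - epoch γ (φ j)).toNNReal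
  have hs : ∀ j, (s j : ℝ) = epoch γ (N j) - epoch γ (φ j) := fun j => Real.coe_toNNReal _ (hs0 j)
  have hslim : Tendsto s atTop (𝓝 t) := by
    rw [← NNReal.tendsto_coe]
    have hγ : Tendsto (fun j => (t : ℝ) - γ (N j)) atTop (𝓝 (t : ℝ)) := by
      simpa using ((tendsto_step_zero hpos hsq).comp hNtop).const_sub (t : ℝ)
    refine tendsto_of_tendsto_of_tendsto_of_le_of_le hγ tendsto_const_nhds (fun j => ?_) fun j => ?_
    · have := lt_epoch_stepIndex_succ hpos hsum (epoch γ (φ j) + t)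
      rw [epoch_succ] at this
      simp only [hs]
      linarith
    · simp only [hs]
      linarith [hst j]
  have hmem : ∀ j, s j ∈ Set.Icc 0 t := fun j =>
    ⟨bot_le, by rw [← NNReal.coe_le_coe, hs]; linarith [hst j]⟩
  have h := (hunif t).tendstoLocallyUniformlyOn.tendsto_comp
    (θlim.continuous.continuousWithinAt (x := t)) ⟨bot_le, le_rfl⟩
    (tendsto_nhdsWithin_iff.2 ⟨hslim, Eventually.of_forall hmem⟩)
  refine h.congr fun j => ?_
  rw [hs, add_sub_cancel, interp_epoch hpos hsum]

/-! ### Time averages -/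

theorem summable_abs_sub_of_monotoneOn {g : ℕ → ℝ} {N : ℕ} {l : ℝ}
    (hg : MonotoneOn g (Set.Ici N)) (hl : Tendsto g atTop (𝓝 l)) :
    Summable fun n => |g (n + 1) - g n| := by
  rw [← summable_nat_add_iff N]
  have hnn : ∀ n, 0 ≤ g (n + N + 1) - g (n + N) := fun n =>
    sub_nonneg.2 (hg (by simp) (by simp; omega) (by omega))
  simp only [abs_of_nonneg (hnn _)]
  have h := (hl.comp (tendsto_add_atTop_nat N)).sub_const (g N)
  refine ((hasSum_iff_tendsto_nat_of_nonneg hnn (l - g N)).2 (h.congr fun n => ?_)).summable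
  have := Finset.sum_range_sub (fun m => g (m + N)) n
  simp only [zero_add, add_right_comm _ 1 N] at this
  exact this.symm

theorem summable_abs_sub_step (hpos : ∀ n, 0 < γ n) (hsq : Summable fun n => γ n ^ 2)
    (hmono : ∃ N, MonotoneOn γ (Set.Ici N) ∨ AntitoneOn γ (Set.Ici N)) :
    Summable fun n => |γ (n + 1) - γ n| := by
  have h0 := tendsto_step_zero hpos hsq
  obtain ⟨N, h | h⟩ := hmono
  · exact summable_abs_sub_of_monotoneOn h h0
  · refine (summable_abs_sub_of_monotoneOn h.neg h0.neg).congr fun n => ?_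
    rw [neg_sub_neg, abs_sub_comm]

/-- Summation by parts: shifting the index of a bounded sequence does not affect the convergence of
a series weighted by step sizes of bounded variation. -/
theorem exists_tendsto_sum_of_shift (hvar : Summable fun n => |γ (n + 1) - γ n|)
    (h0 : Tendsto γ atTop (𝓝 0)) {u v : ℕ → ℝ} {B : ℝ} (hu : ∀ n, |u n| ≤ B)
    (h : ∃ L, Tendsto (fun n => ∑ m ∈ Finset.range n, γ m * (u (m + 1) - v m)) atTop (𝓝 L)) :
    ∃ L, Tendsto (fun n => ∑ m ∈ Finset.range n, γ m * (u m - v m)) atTop (𝓝 L) := by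
  obtain ⟨L, hL⟩ := h
  have hsum : Summable fun m => (γ (m + 1) - γ m) * u (m + 1) := by
    refine Summable.of_norm_bounded (hvar.mul_right B) fun m => ?_
    rw [norm_mul, Real.norm_eq_abs, Real.norm_eq_abs]
    exact mul_le_mul_of_nonneg_left (hu _) (abs_nonneg _)
  have hend : Tendsto (fun n => γ n * u n) atTop (𝓝 0) := by
    refine squeeze_zero_norm (fun n => ?_) (by simpa using (h0.abs.mul_const B))
    rw [norm_mul, Real.norm_eq_abs, Real.norm_eq_abs]
    exact mul_le_mul_of_nonneg_left (hu _) (abs_nonneg _)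
  refine ⟨_, (((hL.add_const (γ 0 * u 0)).sub hend).add hsum.hasSum.tendsto_sum_nat).congr
    fun n => ?_⟩
  induction n with
  | zero => simp
  | succ n ih =>
    simp only [Finset.sum_range_succ] at ih ⊢
    linear_combination ih

theorem intervalIntegrable_comp_stepIndex {w : ℕ → ℝ} {B : ℝ} (hw : ∀ n, |w n| ≤ B) (a b : ℝ) :
    IntervalIntegrable (fun s => w (stepIndex γ s)) volume a b := by
  refine (intervalIntegrable_const (c := B)).mono_fun' ?_ (ae_of_all _ fun s => hw _)
  exact (measurable_from_top.comp (measurable_stepIndex γ)).aestronglyMeasurable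

theorem integral_comp_stepIndex_epoch (hpos : ∀ n, 0 < γ n) (hsum : ¬ Summable γ) {w : ℕ → ℝ}
    {B : ℝ} (hw : ∀ n, |w n| ≤ B) (n : ℕ) :
    ∫ s in (0 : ℝ)..epoch γ n, w (stepIndex γ s) = ∑ m ∈ Finset.range n, γ m * w m := by
  induction n with
  | zero => simp [epoch]
  | succ n ih =>
    rw [Finset.sum_range_succ, ← ih, ← intervalIntegral.integral_add_adjacent_intervals
      (intervalIntegrable_comp_stepIndex hw 0 (epoch γ n))
      (intervalIntegrable_comp_stepIndex hw (epoch γ n) (epoch γ (n + 1)))]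
    congr 1
    have hle : epoch γ n ≤ epoch γ (n + 1) := (strictMono_epoch hpos n.lt_succ_self).le
    rw [intervalIntegral.integral_of_le hle, ← integral_Ico_eq_integral_Ioc,
      setIntegral_congr_fun (g := fun _ => w n) measurableSet_Ico
        fun s hs => by simp only [stepIndex_eq hpos hsum hs.1 hs.2]]
    simp [epoch_succ, (hpos n).le]

/-- If the series `∑ γ(m) w(m)` converges then the integrals of the step function with values `w`
over windows of fixed length tend to `0`. -/
theorem tendsto_setIntegral_window (hpos : ∀ n, 0 < γ n) (hsum : ¬ Summable γ)
    (hsq : Summable fun n => γ n ^ 2) {w : ℕ → ℝ} {B : ℝ} (hw : ∀ n, |w n| ≤ B)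
    (h : ∃ L, Tendsto (fun n => ∑ m ∈ Finset.range n, γ m * w m) atTop (𝓝 L)) (T : ℝ≥0) :
    Tendsto (fun n => ∫ t in Set.Icc 0 T, w (stepIndex γ (epoch γ n + t)) ∂halfLine)
      atTop (𝓝 0) := by
  obtain ⟨L, hL⟩ := h
  let V : ℝ → ℝ := fun t => ∫ s in (0 : ℝ)..t, w (stepIndex γ s)
  have hV : Tendsto V atTop (𝓝 L) := by
    have hrem : Tendsto (fun t => B * γ (stepIndex γ t)) atTop (𝓝 0) := by
      simpa using ((tendsto_step_zero hpos hsq).comp (tendsto_stepIndex hpos hsum)).const_mul B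
    have hmain := hL.comp (tendsto_stepIndex hpos hsum)
    refine tendsto_of_tendsto_of_dist hmain
      (squeeze_zero' (Eventually.of_forall fun _ => dist_nonneg) ?_ hrem)
    filter_upwards [eventually_ge_atTop 0] with t ht
    have h1 := epoch_stepIndex_le hpos hsum ht
    have h2 := lt_epoch_stepIndex_succ hpos hsum t
    rw [epoch_succ] at h2
    have hB : 0 ≤ B := (abs_nonneg _).trans (hw 0)
    rw [Function.comp_apply, ← integral_comp_stepIndex_epoch hpos hsum hw, dist_comm, dist_eq_norm,
      intervalIntegral.integral_interval_sub_left (intervalIntegrable_comp_stepIndex hw _ _)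
        (intervalIntegrable_comp_stepIndex hw _ _)]
    refine (intervalIntegral.norm_integral_le_of_norm_le_const fun s _ => hw _).trans ?_
    rw [abs_of_nonneg (sub_nonneg.2 h1)]
    exact mul_le_mul_of_nonneg_left (by linarith) hB
  have he := tendsto_epoch hpos hsum
  have hdiff : Tendsto (fun n => V (epoch γ n + T) - V (epoch γ n)) atTop (𝓝 0) := by
    simpa using (hV.comp (tendsto_atTop_add_const_right _ (T : ℝ) he)).sub (hV.comp he)
  refine hdiff.congr fun n => ?_
  rw [setIntegral_halfLine T fun t => w (stepIndex γ (epoch γ n + t)),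
    intervalIntegral.integral_comp_add_left (fun t => w (stepIndex γ t)), add_zero,
    intervalIntegral.integral_interval_sub_left (intervalIntegrable_comp_stepIndex hw _ _)
      (intervalIntegrable_comp_stepIndex hw _ _)]

end TimeScale

/-! ### Martingale noise -/

section Noise

/-- For families of probability measures, weak continuity implies measurability. -/
theorem measurable_toMeasure_of_continuous {Z X : Type*} [TopologicalSpace Z] [MeasurableSpace Z]
    [OpensMeasurableSpace Z] [TopologicalSpace X] [MeasurableSpace X] [BorelSpace X]
    [HasOuterApproxClosed X] {q : Z → ProbabilityMeasure X} (hq : Continuous q) :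
    Measurable fun z => (q z : Measure X) := by
  refine .measure_of_isPiSystem_of_isProbabilityMeasure
    (BorelSpace.measurable_eq.trans borel_eq_generateFrom_isClosed) isPiSystem_isClosed
    fun F hF => ?_
  refine ENNReal.measurable_of_tendsto (f := fun n z => ∫⁻ x, hF.apprSeq n x ∂(q z : Measure X))
    (fun n => ?_) (tendsto_pi_nhds.2 fun z => HasOuterApproxClosed.tendsto_lintegral_apprSeq hF _)
  exact ((ProbabilityMeasure.continuous_lintegral_boundedContinuousFunction _).comp hq).measurable

theorem abs_sub_le_two_mul {u v B : ℝ} (hu : |u| ≤ B) (hv : |v| ≤ B) : |u - v| ≤ 2 * B := by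
  rw [abs_le] at *
  constructor <;> linarith

theorem abs_integral_le_of_forall {X : Type*} [MeasurableSpace X] (m : ProbabilityMeasure X)
    {f : X → ℝ} {C : ℝ} (hC : ∀ y, |f y| ≤ C) : |∫ y, f y ∂(m : Measure X)| ≤ C := by
  have h := norm_integral_le_of_norm_le_const (μ := (m : Measure X)) (f := f) (ae_of_all _ hC)
  simpa using h

theorem integral_bind_kernel {α β : Type*} [MeasurableSpace α] [MeasurableSpace β]
    (μ : Measure α) (κ : ProbabilityTheory.Kernel α β) {f : β → ℝ}
    (hf : Integrable f (μ.bind κ)) :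
    ∫ y, f y ∂μ.bind κ = ∫ x, ∫ y, f y ∂κ x ∂μ := by
  rw [Measure.comp_eq_comp_const_apply] at hf ⊢
  rw [ProbabilityTheory.Kernel.integral_comp hf, ProbabilityTheory.Kernel.const_apply]

/-- If `κ` is a conditional law of `Y` given `m`, then integrals against `κ` are conditional
expectations. -/
theorem condExp_comp_of_condLaw {Ω E : Type*} {m m0 : MeasurableSpace Ω} [MeasurableSpace E]
    {P : Measure Ω} [IsProbabilityMeasure P] (hm : m ≤ m0) {Y : Ω → E} (hY : Measurable Y)
    {κ : Ω → ProbabilityMeasure E} (hκ : Measurable[m] fun ω => (κ ω : Measure E))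
    (hlaw : ∀ B, MeasurableSet B → P[(Y ⁻¹' B).indicator (fun _ => (1 : ℝ)) | m] =ᵐ[P]
      fun ω => (κ ω : Measure E).real B)
    {f : E → ℝ} (hf : StronglyMeasurable f) {C : ℝ} (hC : ∀ y, |f y| ≤ C) :
    P[fun ω => f (Y ω) | m] =ᵐ[P] fun ω => ∫ y, f y ∂(κ ω : Measure E) := by
  have hκ0 : Measurable fun ω => (κ ω : Measure E) := hκ.mono hm le_rfl
  let η : ProbabilityTheory.Kernel Ω E := { toFun := fun ω => (κ ω : Measure E), measurable' := hκ0 }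
  have : ProbabilityTheory.IsMarkovKernel η :=
    ⟨fun ω => inferInstanceAs (IsProbabilityMeasure (κ ω : Measure E))⟩
  have hbound : ∀ ω, |∫ y, f y ∂(κ ω : Measure E)| ≤ C := fun ω =>
    abs_integral_le_of_forall _ hC
  have hmeas : StronglyMeasurable[m] fun ω => ∫ y, f y ∂(κ ω : Measure E) := by
    let η' : @ProbabilityTheory.Kernel Ω E m _ :=
      @ProbabilityTheory.Kernel.mk Ω E m _ (fun ω => (κ ω : Measure E)) hκ
    exact StronglyMeasurable.integral_kernel (κ := η') hf
  have hint : Integrable (fun ω => ∫ y, f y ∂(κ ω : Measure E)) P :=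
    Integrable.of_bound (hmeas.mono hm).aestronglyMeasurable C (ae_of_all _ hbound)
  refine (ae_eq_condExp_of_forall_setIntegral_eq hm
    (Integrable.of_bound (hf.comp_measurable hY).aestronglyMeasurable C (ae_of_all _ fun ω => hC _))
    (fun s _ _ => hint.integrableOn) (fun s hs _ => ?_) hmeas.aestronglyMeasurable).symm
  -- On an event of `m`, the law of `Y` is the mixture of the conditional laws.
  have hlaws : (P.restrict s).map Y = (P.restrict s).bind η := by
    ext B hB
    rw [Measure.map_apply hY hB, Measure.restrict_apply (hY hB),
      Measure.bind_apply hB η.measurable.aemeasurable]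
    have h1 : ∫ ω in s, (Y ⁻¹' B).indicator (fun _ => (1 : ℝ)) ω ∂P =
        ∫ ω in s, (κ ω : Measure E).real B ∂P := by
      rw [← setIntegral_condExp hm ((integrable_const 1).indicator (hY hB)) hs]
      exact integral_congr_ae (ae_restrict_of_ae (hlaw B hB))
    rw [show (fun _ : Ω => (1 : ℝ)) = 1 from rfl, integral_indicator_one (hY hB),
      measureReal_restrict_apply (hY hB), measureReal_def] at h1
    rw [← ENNReal.ofReal_toReal (measure_ne_top P (Y ⁻¹' B ∩ s)), h1,
      ofReal_integral_eq_lintegral_ofReal]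
    · refine lintegral_congr fun ω => ?_
      exact ENNReal.ofReal_toReal (measure_ne_top (κ ω : Measure E) B)
    · refine Integrable.of_bound (Measurable.aestronglyMeasurable ?_) 1
        (ae_of_all _ fun ω => ?_)
      · exact (Measure.measurable_coe hB |>.comp hκ0).ennreal_toReal
      · rw [Real.norm_of_nonneg measureReal_nonneg]
        exact measureReal_le_one
    · exact ae_of_all _ fun ω => measureReal_nonneg
  calc ∫ ω in s, ∫ y, f y ∂η ω ∂P = ∫ y, f y ∂(P.restrict s).bind η := by
        refine (integral_bind_kernel _ _ ?_).symm
        rw [← hlaws]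
        exact Integrable.of_bound hf.aestronglyMeasurable C (ae_of_all _ hC)
    _ = ∫ ω in s, f (Y ω) ∂P := by
        rw [← hlaws, integral_map hY.aemeasurable hf.aestronglyMeasurable]

/-- A martingale whose increments have square summable bounds is bounded in `L²`, and hence
converges almost surely. -/
theorem ae_exists_tendsto_sum_of_condExp_eq_zero {Ω : Type*} {m0 : MeasurableSpace Ω}
    {P : Measure Ω} [IsProbabilityMeasure P] (ℱ : Filtration ℕ m0) {D : ℕ → Ω → ℝ} {b : ℕ → ℝ}
    (hD : ∀ n, StronglyMeasurable[ℱ (n + 1)] (D n)) (hb : ∀ n ω, |D n ω| ≤ b n)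
    (hsq : Summable fun n => b n ^ 2) (hzero : ∀ n, P[D n | ℱ n] =ᵐ[P] 0) :
    ∀ᵐ ω ∂P, ∃ L, Tendsto (fun n => ∑ m ∈ Finset.range n, D m ω) atTop (𝓝 L) := by
  set M : ℕ → Ω → ℝ := fun n ω => ∑ m ∈ Finset.range n, D m ω with hM
  have hMsucc : ∀ n, M (n + 1) = M n + D n := fun n => by
    funext ω
    simp [hM, Finset.sum_range_succ]
  have hadapt : StronglyAdapted ℱ M := fun n =>
    Finset.stronglyMeasurable_fun_sum _ fun m hm =>
      (hD m).mono (ℱ.mono (Finset.mem_range.1 hm))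
  have hMb : ∀ n ω, ‖M n ω‖ ≤ ∑ m ∈ Finset.range n, b m := fun n ω =>
    norm_sum_le_of_le _ fun m _ => hb m ω
  have hMmeas : ∀ n, StronglyMeasurable (M n) := fun n => (hadapt n).mono (ℱ.le n)
  have hDmeas : ∀ n, StronglyMeasurable (D n) := fun n => (hD n).mono (ℱ.le _)
  have hMint : ∀ n, Integrable (M n) P := fun n =>
    Integrable.of_bound (hMmeas n).aestronglyMeasurable _ (ae_of_all _ (hMb n))
  have hDint : ∀ n, Integrable (D n) P := fun n =>
    Integrable.of_bound (hDmeas n).aestronglyMeasurable _ (ae_of_all _ (hb n))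
  have hmart : Martingale M ℱ P := by
    refine martingale_of_condExp_sub_eq_zero_nat hadapt hMint fun n => ?_
    rw [hMsucc, add_sub_cancel_left]
    exact hzero n
  have hMDint : ∀ n, Integrable (M n * D n) P := fun n => by
    refine (hDint n).bdd_mul (hMmeas n).aestronglyMeasurable (ae_of_all _ (hMb n))
  -- Increments are orthogonal to the past.
  have horth : ∀ n, ∫ ω, M n ω * D n ω ∂P = 0 := by
    intro n
    have h := condExp_mul_of_stronglyMeasurable_left (hadapt n) (hMDint n) (hDint n)
    have h0 : P[M n * D n | ℱ n] =ᵐ[P] 0 := by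
      filter_upwards [h, hzero n] with ω h1 h2
      simp [h1, h2]
    calc ∫ ω, M n ω * D n ω ∂P = ∫ ω, (P[M n * D n | ℱ n]) ω ∂P :=
          (integral_condExp (ℱ.le n)).symm
      _ = 0 := by rw [integral_congr_ae h0]; simp
  have hM2int : ∀ n, Integrable (fun ω => M n ω ^ 2) P := fun n =>
    Integrable.of_bound ((hMmeas n).pow 2).aestronglyMeasurable _ (ae_of_all _ fun ω => by
      rw [norm_pow]
      exact pow_le_pow_left₀ (norm_nonneg _) (hMb n ω) 2)
  have hD2int : ∀ n, Integrable (fun ω => D n ω ^ 2) P := fun n =>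
    Integrable.of_bound ((hDmeas n).pow 2).aestronglyMeasurable _ (ae_of_all _ fun ω => by
      rw [norm_pow]
      exact pow_le_pow_left₀ (norm_nonneg _) (hb n ω) 2)
  have hL2 : ∀ n, ∫ ω, M n ω ^ 2 ∂P ≤ ∑ m ∈ Finset.range n, b m ^ 2 := by
    intro n
    induction n with
    | zero => simp [hM]
    | succ n ih =>
      have hexp : ∫ ω, M (n + 1) ω ^ 2 ∂P =
          ∫ ω, M n ω ^ 2 ∂P + 2 * ∫ ω, M n ω * D n ω ∂P + ∫ ω, D n ω ^ 2 ∂P := by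
        have hMD2 : Integrable (fun ω => 2 * (M n ω * D n ω)) P := (hMDint n).const_mul 2
        have hsum : Integrable (fun ω => M n ω ^ 2 + 2 * (M n ω * D n ω)) P :=
          (hM2int n).add hMD2
        rw [← integral_const_mul, ← integral_add (hM2int n) hMD2,
          ← integral_add hsum (hD2int n)]
        refine integral_congr_ae (ae_of_all _ fun ω => ?_)
        simp only [hMsucc, Pi.add_apply]
        ring
      have hDle : ∫ ω, D n ω ^ 2 ∂P ≤ b n ^ 2 := by
        have h := integral_mono (hD2int n) (integrable_const (b n ^ 2)) fun ω =>
          sq_le_sq' (abs_le.1 (hb n ω)).1 (abs_le.1 (hb n ω)).2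
        simpa using h
      rw [hexp, horth, Finset.sum_range_succ]
      linarith
  have hL1 : ∀ n, eLpNorm (M n) 1 P ≤ (1 + ∑' m, b m ^ 2).toNNReal := by
    intro n
    rw [eLpNorm_one_eq_lintegral_enorm, ← ofReal_integral_norm_eq_lintegral_enorm (hMint n)]
    refine ENNReal.ofReal_le_ofReal ?_
    have h1 : ∫ ω, ‖M n ω‖ ∂P ≤ ∫ ω, (1 + M n ω ^ 2) ∂P := by
      refine integral_mono (hMint n).norm ((integrable_const 1).add (hM2int n)) fun ω => ?_
      simp only [Real.norm_eq_abs]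
      nlinarith [sq_nonneg (|M n ω| - 1), sq_abs (M n ω)]
    rw [integral_add (integrable_const 1) (hM2int n)] at h1
    have h2 := hsq.sum_le_tsum (Finset.range n) fun m _ => sq_nonneg (b m)
    have h3 := hL2 n
    simp only [integral_const, probReal_univ, smul_eq_mul, one_mul] at h1
    linarith
  exact hmart.submartingale.exists_ae_tendsto_of_bdd hL1

variable {Ω A : Type*} [MeasurableSpace A] {k d : ℕ}
  {x : ℕ → Ω → Euc k} {a : ℕ → Ω → A} {θ : ℕ → Ω → Euc d}

theorem measurable_history (x : ℕ → Ω → Euc k) (a : ℕ → Ω → A) (θ : ℕ → Ω → Euc d) (n : ℕ) :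
    Measurable[history x a θ n] fun ω => (x n ω, a n ω, θ n ω) :=
  Measurable.mono (comap_measurable _)
    (le_iSup₂_of_le (f := fun m (_ : m ∈ Set.Iic n) => MeasurableSpace.comap
      (fun ω => (x m ω, a m ω, θ m ω)) inferInstance) n (Set.mem_Iic.2 le_rfl) le_rfl) le_rfl

variable [MeasurableSpace Ω]

/-- The filtration of the histories. -/
def historyFiltration (hx : ∀ n, Measurable (x n)) (ha : ∀ n, Measurable (a n))
    (hθ : ∀ n, Measurable (θ n)) : Filtration ℕ ‹MeasurableSpace Ω› where
  seq := history x a θ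
  mono' _ _ hij := biSup_mono fun _ h => le_trans h hij
  le' _ := iSup₂_le fun m _ => ((hx m).prodMk ((ha m).prodMk (hθ m))).comap_le

/-- For every bounded continuous test function the weighted noise of the chain converges. -/
theorem ae_exists_tendsto_noise {P : Measure Ω} [IsProbabilityMeasure P] [Finite A]
    [TopologicalSpace A] [DiscreteTopology A] [BorelSpace A] {γ : ℕ → ℝ}
    (hsq : Summable fun n => γ n ^ 2) {p : Euc k → A → Euc d → ProbabilityMeasure (Euc k)}
    (hp : Continuous fun z : Euc k × A × Euc d => p z.1 z.2.1 z.2.2)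
    (hx : ∀ n, Measurable (x n)) (ha : ∀ n, Measurable (a n)) (hθ : ∀ n, Measurable (θ n))
    (hctrl : IsControlled P p x a θ) {f : Euc k → ℝ} (hf : Continuous f) {B : ℝ}
    (hB : ∀ y, |f y| ≤ B) :
    ∀ᵐ ω ∂P, ∃ L, Tendsto (fun n => ∑ m ∈ Finset.range n, γ m *
      (f (x (m + 1) ω) - ∫ y, f y ∂(p (x m ω) (a m ω) (θ m ω) : Measure (Euc k))))
      atTop (𝓝 L) := by
  set ℱ := historyFiltration hx ha hθ
  have hker : ∀ n, Measurable[ℱ n]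
      fun ω => (p (x n ω) (a n ω) (θ n ω) : Measure (Euc k)) := fun n =>
    (measurable_toMeasure_of_continuous hp).comp (measurable_history x a θ n)
  have hpf : ∀ n, StronglyMeasurable[ℱ n]
      fun ω => ∫ y, f y ∂(p (x n ω) (a n ω) (θ n ω) : Measure (Euc k)) := by
    intro n
    let η : @ProbabilityTheory.Kernel Ω (Euc k) (ℱ n) _ :=
      @ProbabilityTheory.Kernel.mk Ω (Euc k) (ℱ n) _ _ (hker n)
    exact StronglyMeasurable.integral_kernel (κ := η) hf.stronglyMeasurable
  have hpfb : ∀ n ω, |∫ y, f y ∂(p (x n ω) (a n ω) (θ n ω) : Measure (Euc k))| ≤ B := fun n ω =>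
    abs_integral_le_of_forall _ hB
  have hfx : ∀ n, StronglyMeasurable[ℱ n] fun ω => f (x n ω) := fun n =>
    hf.stronglyMeasurable.comp_measurable (measurable_fst.comp (measurable_history x a θ n))
  refine ae_exists_tendsto_sum_of_condExp_eq_zero ℱ (b := fun n => |γ n| * (2 * B))
    (D := fun n ω => γ n * (f (x (n + 1) ω) -
      ∫ y, f y ∂(p (x n ω) (a n ω) (θ n ω) : Measure (Euc k)))) ?_ ?_ ?_ ?_
  · intro n
    have h : StronglyMeasurable[ℱ (n + 1)] fun ω => f (x (n + 1) ω) -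
        ∫ y, f y ∂(p (x n ω) (a n ω) (θ n ω) : Measure (Euc k)) :=
      (hfx (n + 1)).sub ((hpf n).mono (ℱ.mono n.le_succ))
    exact h.const_mul (γ n)
  · intro n ω
    have h := mul_le_mul_of_nonneg_left (abs_sub_le_two_mul (hB (x (n + 1) ω)) (hpfb n ω))
      (abs_nonneg (γ n))
    rwa [← abs_mul] at h
  · refine (hsq.mul_right ((2 * B) ^ 2)).congr fun n => ?_
    rw [mul_pow |γ n|, sq_abs]
  · intro n
    have hint1 : Integrable (fun ω => f (x (n + 1) ω)) P :=
      Integrable.of_bound ((hfx (n + 1)).mono (ℱ.le _)).aestronglyMeasurable B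
        (ae_of_all _ fun ω => hB _)
    have hint2 : Integrable
        (fun ω => ∫ y, f y ∂(p (x n ω) (a n ω) (θ n ω) : Measure (Euc k))) P :=
      Integrable.of_bound ((hpf n).mono (ℱ.le _)).aestronglyMeasurable B (ae_of_all _ (hpfb n))
    have hlaw := condExp_comp_of_condLaw (ℱ.le n) (hx (n + 1)) (hker n) (hctrl n)
      hf.stronglyMeasurable hB
    have h1 := condExp_smul (μ := P) (γ n) ((fun ω => f (x (n + 1) ω)) -
      fun ω => ∫ y, f y ∂(p (x n ω) (a n ω) (θ n ω) : Measure (Euc k))) (ℱ n)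
    refine h1.trans ?_
    filter_upwards [hlaw, condExp_sub hint1 hint2 (ℱ n)] with ω h2 h3
    rw [condExp_of_stronglyMeasurable (ℱ.le n) (hpf n) hint2] at h3
    simp [h3, h2]

end Noise

/-! ### Stationarity as a closed condition -/

theorem continuous_integral_prod {X : Type*} [TopologicalSpace X] [CompactSpace X]
    [MeasurableSpace X] [BorelSpace X] :
    Continuous fun w : C(X, ℝ) × ProbabilityMeasure X => ∫ z, w.1 z ∂(w.2 : Measure X) := by
  refine continuous_iff_continuousAt.2 fun ⟨c, m⟩ => ?_
  have h1 : Tendsto (fun w : C(X, ℝ) × ProbabilityMeasure X => ∫ z, c z ∂(w.2 : Measure X))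
      (𝓝 (c, m)) (𝓝 (∫ z, c z ∂(m : Measure X))) :=
    ((ProbabilityMeasure.continuous_integral_continuousMap c).comp continuous_snd).tendsto (c, m)
  have h2 : Tendsto (fun w : C(X, ℝ) × ProbabilityMeasure X => ‖w.1 - c‖) (𝓝 (c, m)) (𝓝 0) := by
    have h : Continuous fun w : C(X, ℝ) × ProbabilityMeasure X => ‖w.1 - c‖ := by fun_prop
    simpa using h.tendsto (c, m)
  refine tendsto_of_tendsto_of_dist h1 (squeeze_zero (fun _ => dist_nonneg) (fun w => ?_) h2)
  rw [dist_comm, Real.dist_eq, ← integral_sub_continuousMap]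
  exact abs_integral_le_norm _ _

section Defect

variable {Θ S X : Type*} [TopologicalSpace Θ]
  [TopologicalSpace S] [CompactSpace S] [MeasurableSpace S] [BorelSpace S]
  [TopologicalSpace X]

/-- For a state space `S`, a space `X` of state-action pairs with projection `π : X → S`, and a
transition kernel `q(dy | θ, z)`, the function `z ↦ f(π z) - ∫ f dq(θ, z)`. The state marginal of a
measure `m` on `X` is stationary for the weights `θ` iff `m` integrates all these functions to
`0`. -/
noncomputable def defect (π : C(X, S)) (q : C(Θ × X, ProbabilityMeasure S)) (f : C(S, ℝ)) :
    C(Θ, C(X, ℝ)) :=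
  ContinuousMap.curry
    ⟨fun w => f (π w.2) - ∫ y, f y ∂(q w : Measure S),
      (f.continuous.comp (π.continuous.comp continuous_snd)).sub
        ((ProbabilityMeasure.continuous_integral_continuousMap f).comp q.continuous)⟩

variable (π : C(X, S)) (q : C(Θ × X, ProbabilityMeasure S))

theorem defect_apply (f : C(S, ℝ)) (θ : Θ) (z : X) :
    defect π q f θ z = f (π z) - ∫ y, f y ∂(q (θ, z) : Measure S) := rfl

theorem abs_defect_le (f : C(S, ℝ)) (θ : Θ) (z : X) : |defect π q f θ z| ≤ 2 * ‖f‖ :=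
  abs_sub_le_two_mul (f.norm_coe_le_norm _) (abs_integral_le_norm _ f)

theorem norm_defect_sub_le [CompactSpace X] (f g : C(S, ℝ)) (θ : Θ) :
    ‖defect π q f θ - defect π q g θ‖ ≤ 2 * ‖f - g‖ := by
  refine (ContinuousMap.norm_le _ (by positivity)).2 fun z => ?_
  have h : (defect π q f θ - defect π q g θ) z = defect π q (f - g) θ z := by
    rw [ContinuousMap.sub_apply, defect_apply, defect_apply, defect_apply,
      integral_sub_continuousMap, ContinuousMap.sub_apply]
    ring
  rw [h]
  exact abs_defect_le π q (f - g) θ z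

end Defect

section ClosedCondition

variable {Θ S X : Type*} [TopologicalSpace Θ]
  [TopologicalSpace S] [CompactSpace S] [MeasurableSpace S] [BorelSpace S]
  [TopologicalSpace X] [CompactSpace X] [MeasurableSpace X] [BorelSpace X]
  (π : C(X, S)) (q : C(Θ × X, ProbabilityMeasure S))

theorem isClosed_defect_integral_eq_zero :
    IsClosed {w : Θ × ProbabilityMeasure X |
      ∀ f : C(S, ℝ), ∫ z, defect π q f w.1 z ∂(w.2 : Measure X) = 0} := by
  simp only [Set.ofPred_forall]
  refine isClosed_iInter fun f => isClosed_eq (continuous_integral_prod.comp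
    (((defect π q f).continuous.comp continuous_fst).prodMk continuous_snd)) continuous_const

theorem defect_integral_eq_zero_of_dense {D : Set C(S, ℝ)} (hD : Dense D) {θ : Θ}
    {m : ProbabilityMeasure X} (h : ∀ f ∈ D, ∫ z, defect π q f θ z ∂(m : Measure X) = 0)
    (f : C(S, ℝ)) : ∫ z, defect π q f θ z ∂(m : Measure X) = 0 := by
  have hlip : LipschitzWith 2 fun f : C(S, ℝ) => ∫ z, defect π q f θ z ∂(m : Measure X) := by
    refine LipschitzWith.of_dist_le_mul fun f g => ?_
    rw [Real.dist_eq, ← integral_sub_continuousMap, dist_eq_norm]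
    exact (abs_integral_le_norm _ _).trans (norm_defect_sub_le π q f g θ)
  have hclosed : IsClosed {f : C(S, ℝ) | ∫ z, defect π q f θ z ∂(m : Measure X) = 0} :=
    isClosed_eq hlip.continuous continuous_const
  exact (hclosed.closure_subset_iff.2 h) (hD f)

end ClosedCondition

/-! ### Limits of the empirical paths -/

theorem integral_shiftedDirac {X : Type*} [TopologicalSpace X] [MeasurableSpace X]
    [BorelSpace X] (γ : ℕ → ℝ) (z : ℕ → X) (n : ℕ) (t : ℝ≥0) (c : C(X, ℝ)) :
    ∫ y, c y ∂(shiftedDirac γ z n t : Measure X) = c (z (stepIndex γ (epoch γ n + t))) := by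
  show ∫ y, c y ∂Measure.dirac (z (stepIndex γ (epoch γ n + t))) = _
  exact integral_dirac' _ _ c.continuous.stronglyMeasurable

section Limits

variable {X : Type*} [TopologicalSpace X] [CompactSpace X] [T2Space X]
  [MeasurableSpace X] [BorelSpace X]

/-- If a closed condition on pairs `(θ, m)` holds along `(θlim t, μ t)` for almost every `t`, then
`μ` can be modified on a null set so that it holds for every `t`. This uses that the probability
measures on a compact space form a compact space. -/
theorem exists_path_forall_mem {Θ : Type*} [TopologicalSpace Θ]
    {G : Set (Θ × ProbabilityMeasure X)} (hG : IsClosed G) (θlim : C(ℝ≥0, Θ)) (μ : MeasurePath X)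
    (h : ∀ᵐ t ∂halfLine, (θlim t, μ t) ∈ G) :
    ∃ ν : MeasurePath X, (∀ᵐ t ∂halfLine, μ t = ν t) ∧ ∀ t, (θlim t, ν t) ∈ G := by
  have hproj : IsClosed (θlim ⁻¹' (Prod.fst '' G)) :=
    (isClosedMap_fst_of_compactSpace _ hG).preimage θlim.continuous
  have hall : ∀ t, ∃ m, (θlim t, m) ∈ G := by
    intro t
    have hdense : Dense (θlim ⁻¹' (Prod.fst '' G)) :=
      dense_of_ae_halfLine (h.mono fun s hs => ⟨_, hs, rfl⟩)
    obtain ⟨⟨θ, m⟩, hm, hθ⟩ := (hproj.closure_eq ▸ hdense t : t ∈ θlim ⁻¹' (Prod.fst '' G))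
    exact ⟨m, by rwa [← (show θ = θlim t from hθ)]⟩
  choose m hm using hall
  classical
  have hae : ∀ᵐ t ∂halfLine, μ t = if (θlim t, μ t) ∈ G then μ t else m t :=
    h.mono fun t ht => (if_pos ht).symm
  refine ⟨⟨fun t => if (θlim t, μ t) ∈ G then μ t else m t, μ.2.congr hae⟩, hae, fun t => ?_⟩
  show (θlim t, if (θlim t, μ t) ∈ G then μ t else m t) ∈ G
  split_ifs with ht
  exacts [ht, hm t]

variable [SecondCountableTopology X] [TopologicalSpace.PseudoMetrizableSpace X] {γ : ℕ → ℝ}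
  {z : ℕ → X} {φ : ℕ → ℕ} {μlim : MeasurePath X}

/-- If the time averages of a curve of test functions along the empirical paths tend to `0`, then the
limit path integrates the test function to `0` at almost every time. -/
theorem ae_integral_eq_zero_of_tendsto
    (hlim : Tendsto (fun j => shiftedDirac γ z (φ j)) atTop (𝓝 μlim)) {c : ℝ≥0 → C(X, ℝ)}
    (hc : Continuous c)
    (hzero : ∀ T : ℝ≥0, Tendsto (fun j => ∫ t in Set.Icc 0 T,
      c t (z (stepIndex γ (epoch γ (φ j) + t))) ∂halfLine) atTop (𝓝 0)) :
    ∀ᵐ t ∂halfLine, ∫ y, c t y ∂(μlim t : Measure X) = 0 := by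
  have hcint : ∀ T, IntegrableOn c (Set.Icc 0 T) halfLine := by
    intro T
    obtain ⟨C, hC⟩ := (isCompact_Icc (a := (0 : ℝ≥0)) (b := T)).exists_bound_of_continuousOn
      hc.continuousOn
    exact Integrable.of_bound hc.aestronglyMeasurable C
      ((ae_restrict_iff' measurableSet_Icc).2 (ae_of_all _ hC))
  refine ae_eq_zero_of_forall_setIntegral_Icc (fun T => integrable_integral_path μlim
    Measure.absolutelyContinuous_restrict (hcint T)) fun T => ?_
  rcases eq_or_ne T 0 with rfl | hT
  · have h0 : halfLine (Set.Icc 0 0) = 0 := by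
      rw [halfLine_apply_Icc, NNReal.coe_zero, ENNReal.ofReal_zero]
    rw [Measure.restrict_eq_zero.2 h0, integral_zero_measure]
  · have h := tendsto_integral_path hlim (pos_iff_ne_zero.2 hT) (hcint T)
    simp only [integral_shiftedDirac] at h
    exact tendsto_nhds_unique h (hzero T)

/-- If the time averages of the defects vanish asymptotically for a dense set of test functions, then
the limit path is stationary at almost every time. -/
theorem ae_forall_defect_integral_eq_zero {Θ S : Type*} [TopologicalSpace Θ] [TopologicalSpace S]
    [CompactSpace S] [MeasurableSpace S] [BorelSpace S] (π : C(X, S))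
    (q : C(Θ × X, ProbabilityMeasure S)) {D : Set C(S, ℝ)} (hDc : D.Countable) (hD : Dense D)
    (hlim : Tendsto (fun j => shiftedDirac γ z (φ j)) atTop (𝓝 μlim)) {θ : ℕ → Θ}
    {θlim : C(ℝ≥0, Θ)}
    (hθ : ∀ (f : C(S, ℝ)) (t : ℝ≥0), Tendsto
      (fun j => defect π q f (θ (stepIndex γ (epoch γ (φ j) + t)))) atTop
      (𝓝 (defect π q f (θlim t))))
    (havg : ∀ f ∈ D, ∀ T : ℝ≥0, Tendsto (fun j => ∫ t in Set.Icc 0 T,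
      (fun n => defect π q f (θ n) (z n)) (stepIndex γ (epoch γ (φ j) + t)) ∂halfLine)
      atTop (𝓝 0)) :
    ∀ᵐ t ∂halfLine, ∀ f : C(S, ℝ), ∫ y, defect π q f (θlim t) y ∂(μlim t : Measure X) = 0 := by
  have key : ∀ᵐ t ∂halfLine, ∀ f ∈ D,
      ∫ y, defect π q f (θlim t) y ∂(μlim t : Measure X) = 0 := by
    refine (ae_ball_iff hDc).2 fun f hf => ?_
    have hc : Continuous fun t => defect π q f (θlim t) :=
      (defect π q f).continuous.comp θlim.continuous
    refine ae_integral_eq_zero_of_tendsto hlim hc fun T => ?_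
    let N : ℕ → ℝ≥0 → ℕ := fun j t => stepIndex γ (epoch γ (φ j) + t)
    have hN : ∀ j, Measurable (N j) := fun j =>
      (measurable_stepIndex γ).comp (measurable_const.add measurable_subtype_coe)
    have hmeas1 : ∀ j, AEStronglyMeasurable (fun t => defect π q f (θlim t) (z (N j t)))
        (halfLine.restrict (Set.Icc 0 T)) := by
      intro j
      have h := aestronglyMeasurable_integral_path (shiftedDirac γ z (φ j))
        (μ := halfLine.restrict (Set.Icc 0 T)) Measure.absolutelyContinuous_restrict
        hc.aestronglyMeasurable
      simpa only [integral_shiftedDirac] using h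
    have hmeas2 : ∀ j, AEStronglyMeasurable (fun t => defect π q f (θ (N j t)) (z (N j t)))
        (halfLine.restrict (Set.Icc 0 T)) := fun j =>
      ((measurable_from_top (f := fun n => defect π q f (θ n) (z n))).comp
        (hN j)).aestronglyMeasurable
    -- The actual weights may be replaced by the limit weights, by dominated convergence.
    have hdiff : Tendsto (fun j => ∫ t in Set.Icc 0 T, (defect π q f (θlim t) (z (N j t)) -
        defect π q f (θ (N j t)) (z (N j t))) ∂halfLine) atTop (𝓝 0) := by
      rw [← integral_zero ℝ≥0 ℝ (μ := halfLine.restrict (Set.Icc 0 T))]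
      refine tendsto_integral_of_dominated_convergence (fun _ => 2 * (2 * ‖f‖))
        (fun j => (hmeas1 j).sub (hmeas2 j)) (integrable_const _) (fun j => ae_of_all _ fun t =>
          abs_sub_le_two_mul (abs_defect_le π q f _ _) (abs_defect_le π q f _ _))
        (ae_of_all _ fun t => ?_)
      have h := tendsto_iff_norm_sub_tendsto_zero.1 (hθ f t)
      refine squeeze_zero_norm (fun j => ?_) h
      rw [norm_sub_rev]
      exact (defect π q f (θ (N j t)) - defect π q f (θlim t)).norm_coe_le_norm _
    have hadd := hdiff.add (havg f hf T)
    rw [add_zero] at hadd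
    refine hadd.congr fun j => ?_
    have hint1 : Integrable (fun t => defect π q f (θlim t) (z (N j t)))
        (halfLine.restrict (Set.Icc 0 T)) :=
      Integrable.of_bound (hmeas1 j) (2 * ‖f‖) (ae_of_all _ fun t => abs_defect_le π q f _ _)
    have hint2 : Integrable (fun t => defect π q f (θ (N j t)) (z (N j t)))
        (halfLine.restrict (Set.Icc 0 T)) :=
      Integrable.of_bound (hmeas2 j) (2 * ‖f‖) (ae_of_all _ fun t => abs_defect_le π q f _ _)
    rw [integral_sub hint1 hint2]
    exact sub_add_cancel _ _
  exact key.mono fun t ht => defect_integral_eq_zero_of_dense π q hD ht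

end Limits

/-! ### The compactified chain -/

section Sphere

variable {k : ℕ}

theorem injective_invStereo (k : ℕ) : Function.Injective (invStereo k) := by
  have : Fact (Module.finrank ℝ (Euc (k + 1)) = k + 1) := ⟨by simp⟩
  intro x y h
  have hr : ∀ x, stereographic' k (northPole k) (invStereo k x) = x := fun x =>
    (stereographic' k (northPole k)).right_inv (by simp)
  rw [← hr x, h, hr]

theorem continuous_invStereo (k : ℕ) : Continuous (invStereo k) := by
  have : Fact (Module.finrank ℝ (Euc (k + 1)) = k + 1) := ⟨by simp⟩
  have h := (stereographic' k (northPole k)).continuousOn_symm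
  rwa [stereographic'_target, continuousOn_univ] at h

/-- By Tietze's theorem, the inverse of `invStereo` on the compact image of a ball extends to a
continuous map on the whole sphere. -/
theorem exists_continuous_leftInverse_invStereo (k : ℕ) (C : ℝ) :
    ∃ r : C(Sph k, Euc k), ∀ x, ‖x‖ ≤ C → r (invStereo k x) = x := by
  have hcont : Continuous fun x : Metric.closedBall (0 : Euc k) C => invStereo k x :=
    (continuous_invStereo k).comp continuous_subtype_val
  have : CompactSpace (Metric.closedBall (0 : Euc k) C) :=
    isCompact_iff_compactSpace.1 (isCompact_closedBall _ _)
  have he : IsClosedEmbedding fun x : Metric.closedBall (0 : Euc k) C => invStereo k x :=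
    hcont.isClosedEmbedding ((injective_invStereo k).comp Subtype.val_injective)
  obtain ⟨r, hr⟩ := ContinuousMap.exists_extension he ⟨Subtype.val, continuous_subtype_val⟩
  refine ⟨r, fun x hx => ?_⟩
  exact congrArg (fun g => g ⟨x, mem_closedBall_zero_iff.2 hx⟩) hr

/-- Transport of a measure on the sphere to `ℝᵏ`. -/
noncomputable def pullState (A : Type*) [MeasurableSpace A]
    (r : C(Sph k, Euc k)) (m : ProbabilityMeasure (Sph k × A)) :
    ProbabilityMeasure (Euc k × A) :=
  m.map (f := Prod.map r id) (r.continuous.measurable.prodMap measurable_id).aemeasurable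

theorem measurable_pullState (A : Type*) [MeasurableSpace A] (r : C(Sph k, Euc k)) :
    Measurable (pullState A r) :=
  ((Measure.measurable_map _ (r.continuous.measurable.prodMap measurable_id)).comp
    measurable_subtype_coe).subtype_mk

variable {A : Type*} [TopologicalSpace A] {d : ℕ}
  {p : Euc k → A → Euc d → ProbabilityMeasure (Euc k)}

/-- The controlled kernel, moved to the sphere by means of a continuous map `r` from the sphere to
`ℝᵏ`. -/
noncomputable def sphereKernel (hp : Continuous fun z : Euc k × A × Euc d => p z.1 z.2.1 z.2.2)
    (r : C(Sph k, Euc k)) : C(Euc d × (Sph k × A), ProbabilityMeasure (Sph k)) where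
  toFun w := (p (r w.2.1) w.2.2 w.1).map (continuous_invStereo k).aemeasurable
  continuous_toFun := (ProbabilityMeasure.continuous_map (continuous_invStereo k)).comp
    (hp.comp (by fun_prop : Continuous fun w : Euc d × (Sph k × A) => (r w.2.1, w.2.2, w.1)))

theorem integral_sphereKernel (hp : Continuous fun z : Euc k × A × Euc d => p z.1 z.2.1 z.2.2)
    (r : C(Sph k, Euc k)) (f : C(Sph k, ℝ)) (w : Euc d × (Sph k × A)) :
    ∫ y, f y ∂(sphereKernel hp r w : Measure (Sph k)) =
      ∫ y, f (invStereo k y) ∂(p (r w.2.1) w.2.2 w.1 : Measure (Euc k)) :=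
  integral_map (continuous_invStereo k).aemeasurable f.continuous.aestronglyMeasurable

/-- The projection to the state. -/
def stateProj (k : ℕ) (A : Type*) [TopologicalSpace A] : C(Sph k × A, Sph k) :=
  ⟨Prod.fst, continuous_fst⟩

/-- The distance by which `invStereo ∘ r` moves the state. It vanishes exactly at the points at which
`r` inverts `invStereo`. -/
noncomputable def displacement (A : Type*) [TopologicalSpace A] (r : C(Sph k, Euc k)) :
    C(Sph k × A, ℝ) :=
  ⟨fun z => dist (invStereo k (r z.1)) z.1,
    ((continuous_invStereo k).comp (r.continuous.comp continuous_fst)).dist continuous_fst⟩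

theorem displacement_apply (r : C(Sph k, Euc k)) (z : Sph k × A) :
    displacement A r z = dist (invStereo k (r z.1)) z.1 := rfl

variable [Finite A] [DiscreteTopology A] [MeasurableSpace A] [BorelSpace A]

theorem ae_invStereo_comp_eq {r : C(Sph k, Euc k)} {m : ProbabilityMeasure (Sph k × A)}
    (h : ∫ z, displacement A r z ∂(m : Measure (Sph k × A)) = 0) :
    ∀ᵐ z ∂(m : Measure (Sph k × A)), invStereo k (r z.1) = z.1 := by
  simp only [displacement_apply] at h
  rw [integral_eq_zero_iff_of_nonneg (fun z => dist_nonneg)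
    (integrable_continuousMap m (displacement A r))] at h
  exact h.mono fun z hz => dist_eq_zero.1 hz

theorem map_pullState {r : C(Sph k, Euc k)} {m : ProbabilityMeasure (Sph k × A)}
    (h : ∫ z, displacement A r z ∂(m : Measure (Sph k × A)) = 0) :
    (pullState A r m : Measure (Euc k × A)).map (Prod.map (invStereo k) id) =
      (m : Measure (Sph k × A)) := by
  have hr : Measurable (Prod.map r id : Sph k × A → Euc k × A) :=
    r.continuous.measurable.prodMap measurable_id
  have hi : Measurable (Prod.map (invStereo k) id : Euc k × A → Sph k × A) :=
    (continuous_invStereo k).measurable.prodMap measurable_id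
  show ((m : Measure (Sph k × A)).map (Prod.map r id)).map _ = _
  rw [Measure.map_map hi hr]
  conv_rhs => rw [← Measure.map_id (μ := (m : Measure (Sph k × A)))]
  exact Measure.map_congr ((ae_invStereo_comp_eq h).mono fun z hz => Prod.ext hz rfl)

/-- A measure that is carried by the states at which `r` inverts `invStereo`, and for which the
compactified chain has vanishing mean defects, comes from a measure with stationary state
marginal. -/
theorem stationaryMarginal_pullState
    (hp : Continuous fun z : Euc k × A × Euc d => p z.1 z.2.1 z.2.2)
    {r : C(Sph k, Euc k)} {m : ProbabilityMeasure (Sph k × A)} {θ : Euc d}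
    (hdisp : ∫ z, displacement A r z ∂(m : Measure (Sph k × A)) = 0)
    (hdef : ∀ f, ∫ z, defect (stateProj k A) (sphereKernel hp r) f θ z
      ∂(m : Measure (Sph k × A)) = 0) :
    StationaryMarginal p θ (pullState A r m) := by
  have hr : Measurable (Prod.map r id : Sph k × A → Euc k × A) :=
    r.continuous.measurable.prodMap measurable_id
  have hi : Measurable (invStereo k) := (continuous_invStereo k).measurable
  have hq : Measurable fun z : Euc k × A => (p z.1 z.2 θ : Measure (Euc k)) :=
    measurable_toMeasure_of_continuous (q := fun z : Euc k × A => p z.1 z.2 θ)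
      (hp.comp (by fun_prop : Continuous fun z : Euc k × A => (z.1, z.2, θ)))
  let κ : ProbabilityTheory.Kernel (Euc k × A) (Euc k) :=
    { toFun := fun z => (p z.1 z.2 θ : Measure (Euc k)), measurable' := hq }
  have : ProbabilityTheory.IsMarkovKernel κ :=
    ⟨fun z => inferInstanceAs (IsProbabilityMeasure (p z.1 z.2 θ : Measure (Euc k)))⟩
  let n : Measure (Euc k × A) := (m : Measure (Sph k × A)).map (Prod.map r id)
  have : IsProbabilityMeasure n := Measure.isProbabilityMeasure_map hr.aemeasurable
  have hn : ∀ g : Euc k × A → ℝ, StronglyMeasurable g →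
      ∫ z, g z ∂n = ∫ z, g (Prod.map r id z) ∂(m : Measure (Sph k × A)) := fun g hg =>
    integral_map hr.aemeasurable hg.aestronglyMeasurable
  have hsphere : (n.map Prod.fst).map (invStereo k) = (n.bind κ).map (invStereo k) := by
    have h1 : IsProbabilityMeasure (n.map Prod.fst) :=
      Measure.isProbabilityMeasure_map measurable_fst.aemeasurable
    have h2 : IsProbabilityMeasure ((n.map Prod.fst).map (invStereo k)) :=
      Measure.isProbabilityMeasure_map hi.aemeasurable
    have h3 : IsProbabilityMeasure ((n.bind κ).map (invStereo k)) :=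
      Measure.isProbabilityMeasure_map hi.aemeasurable
    refine ext_of_forall_integral_eq_of_IsFiniteMeasure fun f => ?_
    have hf : StronglyMeasurable f := f.continuous.stronglyMeasurable
    have hfi : StronglyMeasurable fun y => f (invStereo k y) := hf.comp_measurable hi
    rw [integral_map hi.aemeasurable hf.aestronglyMeasurable,
      integral_map hi.aemeasurable hf.aestronglyMeasurable,
      integral_map measurable_fst.aemeasurable hfi.aestronglyMeasurable,
      integral_bind_kernel _ _ (Integrable.of_bound hfi.aestronglyMeasurable ‖f‖
        (ae_of_all _ fun y => f.norm_coe_le_norm _)),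
      hn (fun z => f (invStereo k z.1)) (hfi.comp_measurable measurable_fst),
      hn (fun z => ∫ y, f (invStereo k y) ∂κ z) (StronglyMeasurable.integral_kernel (κ := κ) hfi)]
    have h0 := hdef f.toContinuousMap
    have hint2 : Integrable (fun z : Sph k × A => ∫ y, f (invStereo k y) ∂κ (Prod.map r id z))
        (m : Measure (Sph k × A)) :=
      Integrable.of_bound ((StronglyMeasurable.integral_kernel (κ := κ) hfi).comp_measurable
        hr).aestronglyMeasurable ‖f‖ (ae_of_all _ fun z =>
          abs_integral_le_of_forall (p (r z.1) z.2 θ) fun y => f.norm_coe_le_norm _)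
    have hint1 : Integrable (fun z : Sph k × A => f z.1) (m : Measure (Sph k × A)) :=
      Integrable.of_bound (hf.comp_measurable measurable_fst).aestronglyMeasurable ‖f‖
        (ae_of_all _ fun z => f.norm_coe_le_norm _)
    have hsplit : ∫ z, defect (stateProj k A) (sphereKernel hp r) f.toContinuousMap θ z
        ∂(m : Measure (Sph k × A)) = ∫ z, f z.1 ∂(m : Measure (Sph k × A)) -
          ∫ z, ∫ y, f (invStereo k y) ∂κ (Prod.map r id z) ∂(m : Measure (Sph k × A)) := by
      rw [← integral_sub hint1 hint2]
      refine integral_congr_ae (ae_of_all _ fun z => ?_)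
      exact congrArg (fun s => f z.1 - s) (integral_sphereKernel hp r f.toContinuousMap (θ, z))
    rw [h0, eq_comm, sub_eq_zero] at hsplit
    rw [← hsplit]
    exact integral_congr_ae ((ae_invStereo_comp_eq hdisp).mono fun z hz => congrArg f hz)
  have hemb : MeasurableEmbedding (invStereo k) :=
    (continuous_invStereo k).measurableEmbedding (injective_invStereo k)
  intro B hB
  have h := congrArg (fun ρ => ρ (invStereo k '' B)) hsphere
  simp only [hemb.map_apply, (injective_invStereo k).preimage_image] at h
  rw [Measure.map_apply measurable_fst hB, Measure.bind_apply hB κ.measurable.aemeasurable] at h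
  rw [Set.prod_univ]
  exact h

end Sphere

/-- The deterministic part of the argument, for a single trajectory `x, a, θ` the noise of which
averages out. The weights enter only through the asymptotic behaviour of the defects. -/
theorem stationaryAlong_of_trajectory {A : Type*} [Finite A] [TopologicalSpace A]
    [DiscreteTopology A] [MeasurableSpace A] [BorelSpace A] {k d : ℕ}
    {γ : ℕ → ℝ} (hγ_pos : ∀ n, 0 < γ n) (hγ_sum : ¬ Summable γ)
    (hγ_sq : Summable fun n => γ n ^ 2)
    (hγ_mono : ∃ N, MonotoneOn γ (Set.Ici N) ∨ AntitoneOn γ (Set.Ici N))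
    {p : Euc k → A → Euc d → ProbabilityMeasure (Euc k)}
    (hp : Continuous fun z : Euc k × A × Euc d => p z.1 z.2.1 z.2.2)
    {x : ℕ → Euc k} {a : ℕ → A} {θ : ℕ → Euc d} {r : C(Sph k, Euc k)}
    (hr : ∀ n, r (invStereo k (x n)) = x n)
    {D : Set C(Sph k, ℝ)} (hDc : D.Countable) (hD : Dense D)
    (hnoise : ∀ f ∈ D, ∃ L, Tendsto (fun n => ∑ m ∈ Finset.range n, γ m *
      (f (invStereo k (x (m + 1))) -
        ∫ y, f (invStereo k y) ∂(p (x m) (a m) (θ m) : Measure (Euc k)))) atTop (𝓝 L))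
    {φ : ℕ → ℕ} (hφ : StrictMono φ) {μlim : MeasurePath (Sph k × A)}
    (hlim : Tendsto (fun j => shiftedDirac γ (fun n => (invStereo k (x n), a n)) (φ j))
      atTop (𝓝 μlim))
    {θlim : C(ℝ≥0, Euc d)}
    (hθ : ∀ (f : C(Sph k, ℝ)) (t : ℝ≥0), Tendsto
      (fun j => defect (stateProj k A) (sphereKernel hp r) f
        (θ (stepIndex γ (epoch γ (φ j) + t)))) atTop
      (𝓝 (defect (stateProj k A) (sphereKernel hp r) f (θlim t)))) :
    StationaryAlong p θlim μlim := by
  have hdef := ae_forall_defect_integral_eq_zero (stateProj k A) (sphereKernel hp r) hDc hD hlim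
    hθ fun f hf T => by
      have hval : ∀ n, defect (stateProj k A) (sphereKernel hp r) f (θ n)
          (invStereo k (x n), a n) = f (invStereo k (x n)) -
            ∫ y, f (invStereo k y) ∂(p (x n) (a n) (θ n) : Measure (Euc k)) := by
        intro n
        rw [defect_apply, integral_sphereKernel, hr]
        rfl
      have hconv := exists_tendsto_sum_of_shift (summable_abs_sub_step hγ_pos hγ_sq hγ_mono)
        (tendsto_step_zero hγ_pos hγ_sq) (fun n => f.norm_coe_le_norm (invStereo k (x n)))
        (hnoise f hf)
      simp only [← hval] at hconv
      exact (tendsto_setIntegral_window hγ_pos hγ_sum hγ_sq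
        (fun n => abs_defect_le (stateProj k A) (sphereKernel hp r) f (θ n)
          (invStereo k (x n), a n)) hconv T).comp hφ.tendsto_atTop
  have hdisp := ae_integral_eq_zero_of_tendsto hlim
    (c := fun _ => displacement A r) continuous_const fun T => by
      have h0 : ∀ n, displacement A r (invStereo k (x n), a n) = 0 := fun n =>
        by
        rw [displacement_apply, hr, dist_self]
      simp only [h0, integral_zero]
      exact tendsto_const_nhds
  have hclosed : IsClosed {w : Euc d × ProbabilityMeasure (Sph k × A) |
      ∫ z, displacement A r z ∂(w.2 : Measure (Sph k × A)) = 0} :=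
    isClosed_eq ((ProbabilityMeasure.continuous_integral_continuousMap _).comp continuous_snd)
      continuous_const
  obtain ⟨ν, hν, hG⟩ := exists_path_forall_mem
    ((isClosed_defect_integral_eq_zero (stateProj k A) (sphereKernel hp r)).inter hclosed)
    θlim μlim (by filter_upwards [hdef, hdisp] with t h1 h2 using ⟨h1, h2⟩)
  refine ⟨⟨fun t => pullState A r (ν t), (measurable_pullState A r).comp_aemeasurable ν.2⟩, ?_,
    fun t => stationaryMarginal_pullState hp (hG t).2 (hG t).1⟩
  filter_upwards [hν] with t ht
  rw [ht]
  exact (map_pullState (hG t).2).symm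

end DQN

/-! ### Stationarity of the limits -/

theorem mainTheorem2
    {Ω : Type*} [MeasurableSpace Ω] (P : Measure Ω) [IsProbabilityMeasure P]
    {A : Type*} [Finite A] [TopologicalSpace A] [DiscreteTopology A]
    [MeasurableSpace A] [BorelSpace A]
    (k d : ℕ)
    -- step sizes
    (γ : ℕ → ℝ) (hγ_pos : ∀ n, 0 < γ n) (hγ_sum : ¬ Summable γ)
    (hγ_sq : Summable fun n => γ n ^ 2)
    (hγ_mono : ∃ N, MonotoneOn γ (Set.Ici N) ∨ AntitoneOn γ (Set.Ici N))
    -- the controlled transition kernel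
    (p : DQN.Euc k → A → DQN.Euc d → ProbabilityMeasure (DQN.Euc k))
    (hp : Continuous fun z : DQN.Euc k × A × DQN.Euc d => p z.1 z.2.1 z.2.2)
    -- states, actions and weights
    (x : ℕ → Ω → DQN.Euc k) (a : ℕ → Ω → A) (θ : ℕ → Ω → DQN.Euc d)
    (hx : ∀ n, Measurable (x n)) (ha : ∀ n, Measurable (a n)) (hθ : ∀ n, Measurable (θ n))
    (hx_bdd : ∀ᵐ ω ∂P, ∃ C : ℝ, ∀ n, ‖x n ω‖ ≤ C)
    (hθ_bdd : ∀ᵐ ω ∂P, ∃ C : ℝ, ∀ n, ‖θ n ω‖ ≤ C)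
    (hctrl : DQN.IsControlled P p x a θ) :
    ∀ᵐ ω ∂P, ∀ (φ : ℕ → ℕ) (μlim : DQN.MeasurePath (DQN.Sph k × A)),
      StrictMono φ →
      Tendsto
        (fun j => DQN.shiftedDirac γ (fun n => (DQN.invStereo k (x n ω), a n ω)) (φ j))
        atTop (𝓝 μlim) →
      (∀ θlim : C(ℝ≥0, DQN.Euc d),
        (∀ T : ℝ≥0, TendstoUniformlyOn
          (fun j (t : ℝ≥0) => DQN.interp γ (fun n => θ n ω) (DQN.epoch γ (φ j) + t))
          θlim atTop (Set.Icc 0 T)) →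
        DQN.StationaryAlong p θlim μlim) ∧
      ((∀ y b θ₁ θ₂, p y b θ₁ = p y b θ₂) →
        ∀ θlim : ℝ≥0 → DQN.Euc d, DQN.StationaryAlong p θlim μlim) := by

  obtain ⟨D, hDc, hD⟩ := TopologicalSpace.exists_countable_dense C(DQN.Sph k, ℝ)
  -- The exceptional set does not depend on the test function, as these range over the countable `D`.
  have hnoise : ∀ᵐ ω ∂P, ∀ f ∈ D, ∃ L, Tendsto (fun n => ∑ m ∈ Finset.range n, γ m *
      (f (DQN.invStereo k (x (m + 1) ω)) - ∫ y, f (DQN.invStereo k y)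
        ∂(p (x m ω) (a m ω) (θ m ω) : Measure (DQN.Euc k)))) atTop (𝓝 L) :=
    (ae_ball_iff hDc).2 fun f _ => DQN.ae_exists_tendsto_noise hγ_sq hp hx ha hθ hctrl
      (f := fun y => f (DQN.invStereo k y)) (f.continuous.comp (DQN.continuous_invStereo k))
      fun y => f.norm_coe_le_norm (DQN.invStereo k y)
  filter_upwards [hnoise, hx_bdd] with ω hω ⟨C, hC⟩ φ μlim hφ hlim
  obtain ⟨r, hr⟩ := DQN.exists_continuous_leftInverse_invStereo k C
  have main : ∀ θlim : C(ℝ≥0, DQN.Euc d), _ → DQN.StationaryAlong p θlim μlim := fun θlim =>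
    DQN.stationaryAlong_of_trajectory hγ_pos hγ_sum hγ_sq hγ_mono hp (fun n => hr _ (hC n))
      hDc hD hω hφ hlim
  refine ⟨fun θlim hunif => main θlim fun f t => ?_, fun hconst θlim => ?_⟩
  · exact ((DQN.defect _ _ f).continuous.tendsto _).comp
      (DQN.tendsto_weights hγ_pos hγ_sum hγ_sq hφ hunif t)
  · -- The kernel does not depend on the weights, so that any limit curve serves, for instance `0`.
    have hdefect : ∀ (f : C(DQN.Sph k, ℝ)) (θ₁ θ₂ : DQN.Euc d),
        DQN.defect (DQN.stateProj k A) (DQN.sphereKernel hp r) f θ₁ =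
          DQN.defect (DQN.stateProj k A) (DQN.sphereKernel hp r) f θ₂ := by
      intro f θ₁ θ₂
      ext z
      rw [DQN.defect_apply, DQN.defect_apply, DQN.integral_sphereKernel,
        DQN.integral_sphereKernel, hconst _ _ θ₁ θ₂]
    obtain ⟨ν, hν, hstat⟩ := main (ContinuousMap.const _ 0) fun f t =>
      tendsto_const_nhds.congr fun j => hdefect f _ _
    refine ⟨ν, hν, fun t B hB => (hstat t B hB).trans ?_⟩
    simp only [hconst _ _ (θlim t) (ContinuousMap.const ℝ≥0 0 t)]
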